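/- A \emph{word} is a finite (possibly empty) string of positive integers. Define maps $\mathsf{fast}$ and $\mathsf{slow}$ from words to words recursively by $\mathsf{fast}(\varepsilon)=\mathsf{slow}(\varepsilon)=\varepsilon$ for the empty word $\varepsilon$ and, for a nonempty word $w=A_1nA_2n\cdots nA_{k+1}$, where $n$ is the largest letter of $w$, occurring exactly $k$ times, by $$\mathsf{fast}(w)=\mathsf{fast}(A_1)\mathsf{fast}(A_2)\cdots\mathsf{fast}(A_{k+1})\underbrace{n\cdots n}_{k},\qquad \mathsf{slow}(w)=\mathsf{slow}(A_1)\,\mathsf{slow}(A_2)\,n\,\mathsf{slow}(A_3)\,n\cdots\mathsf{slow}(A_{k+1})\,n .$$ Let $w=w_1\cdots w_m$ be a word. A \emph{hook} of $w$ is given by two points $(i,w_i)$, $(j,w_j)$ with $i<j$ and $w_i\le w_j$, called its southwest and northeast endpoints; it is drawn as the vertical segment from $(i,w_i)$ to $(i,w_j)$ followed by the horizontal segment from $(i,w_j)$ to $(j,w_j)$. It is \emph{horizontal} if $w_i=w_j$, \emph{small} if $j=i+1$, and a \emph{descent hook} if $i$ is a \emph{descent} of $w$, that is, $i\le m-1$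 and $w_i\ge w_{i+1}$. A \emph{valid hook configuration} of $w$ is a tuple $\mathscr H=(H_1,\ldots,H_k)$, $k\ge 0$, of hooks of $w$, where $H_u$ has endpoints $(i_u,w_{i_u})$ and $(j_u,w_{j_u})$, such that 1. $i_1<\cdots<i_k$; 2. for every descent $d$ of $w$, the point $(d,w_d)$ is the southwest endpoint of some $H_u$; 3. every northeast endpoint of a hook of $\mathscr H$ is the northeast endpoint of a descent hook of $\mathscr H$ and of a small hook of $\mathscr H$ (possibly the same hook); 4. for all $u,v$, the real open intervals $(i_u,j_u)$ and $(i_v,j_v)$ are disjoint or one contains the other. It is \emph{binary} if every point is the northeast endpoint of at most two hooks of $\mathscr H$. For each point $(i,w_i)$ consider the hooks $H_u$ for which either $j_u=i$, or $i_u<i<j_u$ and $w_i\le w_{j_u}$. If there are none, the point is colored by the sky; otherwise it receives the color of the one among these hooks with the rightmost southwest endpoint. Let $q^{\mathscr H}=(q_0,q_1,\ldots,q_k)$, where $q_0$ is the number of points colored by the sky and $q_r$ is the number of points with the color of $H_r$ for $1\le r\le k$. For $q=(q_0,\ldots,q_k)$ put $C_q=\prod_{t=0}^{k}C_{q_t}$,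 where $C_n=\frac{1}{n+1}\binom{2n}{n}$. Let $\mathcal H_{\mathcal R}(w)$ be the set of binary valid hook configurations of $w$ in which every horizontal hook is small, and let $\mathcal H_{\mathcal L}(w)$ be the set of binary valid hook configurations of $w$ in which no small horizontal hook has the same northeast endpoint as another hook of the configuration. Then for every word $w$ the sets $\mathsf{fast}^{-1}(w)$ and $\mathsf{slow}^{-1}(w)$ are finite and $$|\mathsf{fast}^{-1}(w)|=\sum_{\mathscr H\in\mathcal H_{\mathcal R}(w)}C_{q^{\mathscr H}},\qquad |\mathsf{slow}^{-1}(w)|=\sum_{\mathscr H\in\mathcal H_{\mathcal L}(w)}C_{q^{\mathscr H}} .$$ -/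

import Mathlib

namespace StackSortWords

/-- Words: finite strings over the alphabet of positive integers. -/
abbrev Word : Type := List ℕ+

theorem length_le_of_mem_splitOn {w A : Word} {n : ℕ+}
    (hA : A ∈ w.splitOn n) : A.length ≤ w.length := by
  induction w generalizing A with
  | nil => simp_all
  | cons x t ih =>
    rw [List.splitOn_cons_eq_if_modifyHead] at hA
    split_ifs at hA with hx
    · rcases List.mem_cons.1 hA with rfl | hA
      · simp
      · exact (ih hA).trans (by simp)
    · cases hs : t.splitOn n with
      | nil => simp at hs
      | cons B S =>
        rw [hs] at hA ih
        rcases List.mem_cons.1 hA with rfl | hA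
        · simpa using ih (List.mem_cons_self)
        · exact (ih (List.mem_cons_of_mem _ hA)).trans (by simp)

theorem length_lt_of_mem_splitOn {w A : Word} {n : ℕ+} (hn : n ∈ w)
    (hA : A ∈ w.splitOn n) : A.length < w.length := by
  obtain ⟨s, t, rfl⟩ := List.append_of_mem hn
  rw [List.splitOn_append_cons_self, List.mem_append] at hA
  simp only [List.length_append, List.length_cons]
  rcases hA with hA | hA <;> have := length_le_of_mem_splitOn hA <;> omega

/-- If `w` is nonempty with largest letter `n` and `w = A₁ n A₂ n ⋯ n Aₖ₊₁` (no `n` in any `Aᵢ`),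
then `fast w = fast A₁ ⋯ fast Aₖ₊₁ n ⋯ n` with `k` copies of `n` at the end. -/
def fast (w : Word) : Word :=
  if h : w = [] then []
  else
    ((w.splitOn (w.max h)).attach.flatMap fun A => fast A.1) ++
      List.replicate (w.count (w.max h)) (w.max h)
termination_by w.length
decreasing_by exact length_lt_of_mem_splitOn (List.max_mem h) A.2

/-- If `w` is nonempty with largest letter `n` and `w = A₁ n A₂ n ⋯ n Aₖ₊₁` (no `n` in any `Aᵢ`),
then `slow w = (slow A₁) (slow A₂) n (slow A₃) n ⋯ (slow Aₖ₊₁) n`. -/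
def slow (w : Word) : Word :=
  if h : w = [] then []
  else
    (((w.splitOn (w.max h)).attach.take 1).flatMap fun A => slow A.1) ++
      (((w.splitOn (w.max h)).attach.drop 1).flatMap fun A => slow A.1 ++ [w.max h])
termination_by w.length
decreasing_by all_goals exact length_lt_of_mem_splitOn (List.max_mem h) A.2

theorem fast_nil : fast [] = [] := by
  rw [fast]; simp

theorem slow_nil : slow [] = [] := by
  rw [slow]; simp

theorem fast_of_ne_nil {w : Word} (h : w ≠ []) :
    fast w = (w.splitOn (w.max h)).flatMap fast ++
      List.replicate (w.count (w.max h)) (w.max h) := by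
  rw [fast, dif_neg h]
  congr 1
  conv_rhs => rw [← List.attach_map_subtype_val (w.splitOn (w.max h))]
  rw [List.flatMap_map]

theorem slow_of_ne_nil {w : Word} (h : w ≠ []) :
    slow w = ((w.splitOn (w.max h)).take 1).flatMap slow ++
      ((w.splitOn (w.max h)).drop 1).flatMap fun A => slow A ++ [w.max h] := by
  rw [slow, dif_neg h]
  conv_rhs => rw [← List.attach_map_subtype_val (w.splitOn (w.max h))]
  rw [← List.map_take, ← List.map_drop, List.flatMap_map, List.flatMap_map]

/-- A hook of `w`, given by the positions of its southwest endpoint `(sw, w[sw])` and its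
northeast endpoint `(ne, w[ne])` in the plot of `w` (positions are counted from `0`). -/
@[ext]
structure Hook (w : Word) where
  sw : Fin w.length
  ne : Fin w.length
  sw_lt_ne : sw < ne
  letter_le : w[sw] ≤ w[ne]

/-- `d` is a descent of `w`: `d + 1` is also a position and `w_d ≥ w_{d+1}`. -/
def IsDescent (w : Word) (d : Fin w.length) : Prop :=
  ∃ h : (d : ℕ) + 1 < w.length, w[(d : ℕ) + 1] ≤ w[d]

namespace Hook

variable {w : Word}

instance : Finite (Hook w) :=
  Finite.of_injective (fun H : Hook w => (H.sw, H.ne)) fun H K h => by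
    simp only [Prod.mk.injEq] at h
    exact Hook.ext h.1 h.2

/-- The southwest endpoint is a descent top. -/
def IsDescentHook (H : Hook w) : Prop := IsDescent w H.sw

/-- Both endpoints have the same height. -/
def IsHorizontal (H : Hook w) : Prop := w[H.sw] = w[H.ne]

/-- The endpoints are in adjacent positions. -/
def IsSmall (H : Hook w) : Prop := (H.ne : ℕ) = H.sw + 1

/-- The hook lies (weakly) above the point `(i, w[i])`; the endpoints of a hook do not lie
below it. -/
def LiesAbove (H : Hook w) (i : Fin w.length) : Prop :=
  H.sw < i ∧ i < H.ne ∧ w[i] ≤ w[H.ne]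

end Hook

/-- Tuples `(H₁, …, Hₖ)` of hooks of `w`, of any length `k ≥ 0`. -/
abbrev HookTuple (w : Word) : Type := Σ k : ℕ, Fin k → Hook w

namespace HookTuple

variable {w : Word}

/-- Valid hook configurations. In `nested`, the first two alternatives say that the (real) open
intervals `(i_u, j_u)` and `(i_v, j_v)` are disjoint, the last two that one contains the other. -/
structure IsValid (H : HookTuple w) : Prop where
  sw_strictMono : StrictMono fun u => (H.2 u).sw
  descent : ∀ d, IsDescent w d → ∃ u, (H.2 u).sw = d
  northeast : ∀ u, (∃ v, (H.2 v).ne = (H.2 u).ne ∧ (H.2 v).IsDescentHook) ∧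
    ∃ v, (H.2 v).ne = (H.2 u).ne ∧ (H.2 v).IsSmall
  nested : ∀ u v,
    ((H.2 u).ne ≤ (H.2 v).sw ∨ (H.2 v).ne ≤ (H.2 u).sw) ∨
    ((H.2 u).sw ≤ (H.2 v).sw ∧ (H.2 v).ne ≤ (H.2 u).ne) ∨
    ((H.2 v).sw ≤ (H.2 u).sw ∧ (H.2 u).ne ≤ (H.2 v).ne)

/-- Every point is the northeast endpoint of at most two hooks. -/
def IsBinary (H : HookTuple w) : Prop :=
  ∀ j : Fin w.length, {u | (H.2 u).ne = j}.ncard ≤ 2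

/-- The point at position `i` sees the hook `H_u` when looking up: the hook lies above the point
or has it as its northeast endpoint. -/
def Sees (H : HookTuple w) (i : Fin w.length) (u : Fin H.1) : Prop :=
  (H.2 u).LiesAbove i ∨ (H.2 u).ne = i

/-- The point at position `i` receives the color of the sky. -/
def HasSkyColor (H : HookTuple w) (i : Fin w.length) : Prop :=
  ∀ u, ¬ H.Sees i u

/-- The point at position `i` receives the color of `H_u`: among the hooks it sees, `H_u` is the
one with the rightmost southwest endpoint. -/
def HasColor (H : HookTuple w) (i : Fin w.length) (u : Fin H.1) : Prop :=
  H.Sees i u ∧ ∀ v, H.Sees i v → (H.2 v).sw ≤ (H.2 u).sw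

/-- The induced composition `(q₀, q₁, …, qₖ)`: `q₀` counts the points with the color of the sky,
and `q_r` for `r ≥ 1` those with the color of the `r`-th hook. -/
noncomputable def q (H : HookTuple w) : Fin (H.1 + 1) → ℕ :=
  Fin.cons {i | H.HasSkyColor i}.ncard fun u => {i | H.HasColor i u}.ncard

theorem finite_isValid (w : Word) : {H : HookTuple w | H.IsValid}.Finite := by
  have hfin : (Set.range fun x : Σ k : Fin (w.length + 1), (Fin k → Hook w) =>
      (⟨x.1, x.2⟩ : HookTuple w)).Finite := Set.finite_range _
  refine hfin.subset ?_
  rintro ⟨k, H⟩ hH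
  have hk : k ≤ w.length := by
    simpa using Fintype.card_le_of_injective _ hH.sw_strictMono.injective
  exact ⟨⟨⟨k, Nat.lt_succ_of_le hk⟩, H⟩, rfl⟩

end HookTuple

/-- `C_q = C_{q₀} ⋯ C_{qₖ}`, a product of Catalan numbers. -/
def catalanProd {k : ℕ} (q : Fin k → ℕ) : ℕ := ∏ t, catalan (q t)

/-- The binary valid hook configurations of `w` in which every horizontal hook is small. -/
noncomputable def hooksR (w : Word) : Finset (HookTuple w) :=
  ((HookTuple.finite_isValid w).subset (Set.sep_subset _ fun H =>
    H.IsBinary ∧ ∀ u, (H.2 u).IsHorizontal → (H.2 u).IsSmall)).toFinset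

/-- The binary valid hook configurations of `w` in which no small horizontal hook has the same
northeast endpoint as another hook. -/
noncomputable def hooksL (w : Word) : Finset (HookTuple w) :=
  ((HookTuple.finite_isValid w).subset (Set.sep_subset _ fun H =>
    H.IsBinary ∧ ∀ u, (H.2 u).IsSmall → (H.2 u).IsHorizontal →
      ∀ v, v ≠ u → (H.2 v).ne ≠ (H.2 u).ne)).toFinset

theorem mem_hooksR {w : Word} {H : HookTuple w} :
    H ∈ hooksR w ↔ H.IsValid ∧ H.IsBinary ∧
      ∀ u, (H.2 u).IsHorizontal → (H.2 u).IsSmall := by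
  simp [hooksR]

theorem mem_hooksL {w : Word} {H : HookTuple w} :
    H ∈ hooksL w ↔ H.IsValid ∧ H.IsBinary ∧
      ∀ u, (H.2 u).IsSmall → (H.2 u).IsHorizontal →
        ∀ v, v ≠ u → (H.2 v).ne ≠ (H.2 u).ne := by
  simp [hooksL]

end StackSortWords

/-! Both maps read a word in postorder. If `n` is the largest letter of `A n B`, the image is that
of `A`, then that of `B`, then `n`, provided the cut is at the first `n` for `fast` (letters of `A`
below `n`) and at the last `n` for `slow` (letters of `B` below `n`). So the preimages of `f l, …, f
r` have root letter `f r`, and their number is a sum over cuts `c` of products of the numbers for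
`[l, c)` and `[c, r)`, restricted to cuts whose letters obey the rule
(`IsPostorder.ncard_preimage_succ`).

The weighted sum over hook configurations satisfies the same recursion (`configSum_catalan_succ`).
The hooks ending at the last position `r` are none, a single small horizontal hook, or a small hook
together with a longer one from some `c - 1`. In the last case the long hook takes over exactly the
sky points of `[c, r)`, so its Catalan factor plays the role of the sky factor there, and the
contribution is the product of the sums for `[l, c)` and `[c, r)`. In the first case the sky gains a
point. Then `C_{m+1} = ∑ C_i C_{m-i}` divides the sky points into an initial and a final group, and
cutting before the final group again gives products over two intervals (`configSum_conv`); these are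
the cuts at ascents `c - 1`, while long hooks account for the others. When `f (r - 1) = f r`, all
inner cuts come from long hooks and the single small hook gives the one admissible end cut.

The argument is uniform in an abstract rule `IsChildRule`, with one instance for each map. -/

namespace StackSortWords

/-! ### Decomposing configurations by the hooks that end at the last position -/

section Configurations

variable {α : Type*} [LinearOrder α]

/-- Hook configurations on the interval `[l, r)` of positions of the letter sequence `f`, given as
sets of pairs of a southwest and a northeast position. The condition `Q` is imposed on the letters
at `s`, `e - 1`, `e` for each hook from `s` to `e` that is not small. -/
structure Valid (Q : α → α → α → Prop) (f : ℕ → α) (l r : ℕ) (S : Finset (ℕ × ℕ)) : Prop where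
  bounds : ∀ s e, (s, e) ∈ S → l ≤ s ∧ s < e ∧ e < r ∧ f s ≤ f e
  unique : ∀ s e e', (s, e) ∈ S → (s, e') ∈ S → e = e'
  descent : ∀ d, l ≤ d → d + 1 < r → f (d + 1) ≤ f d → ∃ e, (d, e) ∈ S
  small : ∀ s e, (s, e) ∈ S → (e - 1, e) ∈ S
  descentHook : ∀ s e, (s, e) ∈ S → ∃ d, (d, e) ∈ S ∧ f (d + 1) ≤ f d
  nested : ∀ s e s' e', (s, e) ∈ S → (s', e') ∈ S → s < s' → e ≤ s' ∨ e' ≤ e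
  binary : ∀ s s' e, (s, e) ∈ S → (s', e) ∈ S → s + 1 < e → s' + 1 < e → s = s'
  edge : ∀ s e, (s, e) ∈ S → s + 1 < e → Q (f s) (f (e - 1)) (f e)

/-- The condition for hooks from `c - 1` and from `r - 1` to share the northeast endpoint `r`. -/
def Joinable (Q : α → α → α → Prop) (f : ℕ → α) (c r : ℕ) : Prop :=
  f (c - 1) ≤ f r ∧ f (r - 1) ≤ f r ∧ (f c ≤ f (c - 1) ∨ f r ≤ f (r - 1)) ∧
    Q (f (c - 1)) (f (r - 1)) (f r)

variable {Q : α → α → α → Prop} {f : ℕ → α} {l r c : ℕ} {S A B : Finset (ℕ × ℕ)}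

theorem valid_self_iff : Valid Q f l l S ↔ S = ∅ := by
  constructor
  · intro h
    refine Finset.eq_empty_of_forall_notMem ?_
    rintro ⟨s, e⟩ hs
    have := h.bounds s e hs
    omega
  · rintro rfl
    constructor <;> simp
    intros; omega

theorem Valid.notMem_ne (h : Valid Q f l r S) {s e : ℕ} (he : r ≤ e) : (s, e) ∉ S := fun hs => by
  have := h.bounds s e hs
  omega

/-- A hook from `r - 1` could only end at `r`. If no hook ends there, `r - 1` cannot be a descent.
-/
theorem valid_succ_iff_of_forall_notMem (hS : ∀ s, (s, r) ∉ S) (hlr : l ≤ r) :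
    Valid Q f l (r + 1) S ↔ Valid Q f l r S ∧ (l = r ∨ f (r - 1) < f r) := by
  constructor
  · intro h
    have hb : ∀ s e, (s, e) ∈ S → l ≤ s ∧ s < e ∧ e < r ∧ f s ≤ f e := fun s e hs => by
      obtain ⟨h1, h2, h3, h4⟩ := h.bounds s e hs
      refine ⟨h1, h2, ?_, h4⟩
      by_contra h5
      obtain rfl : e = r := by omega
      exact hS s hs
    refine ⟨⟨hb, h.unique, fun d h1 h2 => h.descent d h1 (by omega), h.small, h.descentHook,
      h.nested, h.binary, h.edge⟩, ?_⟩
    by_contra! hc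
    obtain ⟨e, he⟩ := h.descent (r - 1) (by omega) (by omega)
      (by rw [Nat.sub_add_cancel (by omega)]; exact hc.2)
    have := hb _ _ he
    omega
  · rintro ⟨h, hr⟩
    refine ⟨fun s e hs => ?_, h.unique, fun d h1 h2 h3 => ?_, h.small, h.descentHook,
      h.nested, h.binary, h.edge⟩
    · obtain ⟨h1, h2, h3, h4⟩ := h.bounds s e hs
      exact ⟨h1, h2, by omega, h4⟩
    · rcases Nat.lt_or_ge (d + 1) r with h4 | h4
      · exact h.descent d h1 h4 h3
      · obtain rfl : r = d + 1 := by omega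
        rcases hr with hr | hr
        · omega
        · exact absurd h3 (not_le.2 hr)

theorem Valid.insert_small (h : Valid Q f l r S) (hlr : l < r) (hr : f (r - 1) = f r) :
    Valid Q f l (r + 1) (insert (r - 1, r) S) := by
  obtain ⟨r, rfl⟩ : ∃ k, r = k + 1 := ⟨r - 1, by omega⟩
  simp only [Nat.add_sub_cancel] at hr ⊢
  have hb := h.bounds
  constructor <;> simp only [Finset.mem_insert, Prod.mk.injEq]
  · grind
  · grind [h.unique]
  · intro d h1 h2 h3
    rcases Nat.lt_or_ge (d + 1) (r + 1) with h4 | h4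
    · obtain ⟨e, he⟩ := h.descent d h1 h4 h3
      exact ⟨e, .inr he⟩
    · exact ⟨r + 1, .inl ⟨by omega, rfl⟩⟩
  · grind [h.small]
  · rintro s e (⟨rfl, rfl⟩ | hs)
    · exact ⟨s, .inl ⟨rfl, rfl⟩, hr.ge⟩
    · obtain ⟨d, hd, hd'⟩ := h.descentHook s e hs
      exact ⟨d, .inr hd, hd'⟩
  · rintro s e s' e' (⟨rfl, rfl⟩ | hs) (⟨rfl, rfl⟩ | hs') hlt
    · omega
    · have := hb _ _ hs'; omega
    · have := hb _ _ hs; omega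
    · exact h.nested _ _ _ _ hs hs' hlt
  · grind [h.binary]
  · grind [h.edge]

/-- If the small hook is the only one ending at `r`, it must itself be the required descent hook. A
hook cannot go down, so it is horizontal. -/
theorem Valid.erase_small (h : Valid Q f l (r + 1) S) (hS : (r - 1, r) ∈ S)
    (hu : ∀ s, (s, r) ∈ S → s = r - 1) :
    Valid Q f l r (S.erase (r - 1, r)) ∧ l < r ∧ f (r - 1) = f r := by
  have hb := h.bounds
  obtain ⟨h1, h2, h3, h4⟩ := hb _ _ hS
  obtain ⟨r, rfl⟩ : ∃ k, r = k + 1 := ⟨r - 1, by omega⟩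
  simp only [Nat.add_sub_cancel] at *
  refine ⟨?_, by omega, ?_⟩
  · constructor <;> simp only [Finset.mem_erase, Prod.mk.injEq, ne_eq]
    · grind
    · grind [h.unique]
    · intro d h5 h6 h7
      obtain ⟨e, he⟩ := h.descent d h5 (by omega) h7
      exact ⟨e, by omega, he⟩
    · grind [h.small]
    · rintro s e ⟨hs, hs'⟩
      obtain ⟨d, hd, hd'⟩ := h.descentHook s e hs'
      exact ⟨d, ⟨by grind, hd⟩, hd'⟩
    · exact fun s e s' e' hs hs' => h.nested _ _ _ _ hs.2 hs'.2
    · grind [h.binary]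
    · grind [h.edge]
  · obtain ⟨d, hd, hdesc⟩ := h.descentHook _ _ hS
    obtain rfl := hu d hd
    exact le_antisymm h4 hdesc

/-- Glue configurations of `[l, c)` and `[c, r)` by hooks from `c - 1` and `r - 1` to `r`. -/
def joinHooks (c r : ℕ) (A B : Finset (ℕ × ℕ)) : Finset (ℕ × ℕ) :=
  insert (c - 1, r) (insert (r - 1, r) (A ∪ B))

theorem mem_join {s e : ℕ} : (s, e) ∈ joinHooks c r A B ↔
    (s = c - 1 ∧ e = r) ∨ (s = r - 1 ∧ e = r) ∨ (s, e) ∈ A ∨ (s, e) ∈ B := by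
  simp [joinHooks]

theorem Valid.join (hA : Valid Q f l c A) (hB : Valid Q f c r B) (hlc : l < c) (hcr : c < r)
    (hc : Joinable Q f c r) : Valid Q f l (r + 1) (joinHooks c r A B) := by
  obtain ⟨r, rfl⟩ : ∃ k, r = k + 1 := ⟨r - 1, by omega⟩
  obtain ⟨c, rfl⟩ : ∃ k, c = k + 1 := ⟨c - 1, by omega⟩
  obtain ⟨c1, c2, c3, c4⟩ := hc
  have bA := hA.bounds
  have bB := hB.bounds
  constructor <;> simp only [mem_join, Nat.add_sub_cancel] at *
  · grind
  · grind [hA.unique, hB.unique]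
  · intro d h1 h2 h3
    rcases Nat.lt_or_ge (d + 1) (c + 1) with h4 | h4
    · obtain ⟨e, he⟩ := hA.descent d h1 h4 h3
      exact ⟨e, .inr (.inr (.inl he))⟩
    rcases Nat.eq_or_lt_of_le h4 with h4 | h4
    · exact ⟨r + 1, .inl ⟨by omega, rfl⟩⟩
    rcases Nat.lt_or_ge (d + 1) (r + 1) with h5 | h5
    · obtain ⟨e, he⟩ := hB.descent d (by omega) h5 h3
      exact ⟨e, .inr (.inr (.inr he))⟩
    · exact ⟨r + 1, .inr (.inl ⟨by omega, rfl⟩)⟩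
  · grind [hA.small, hB.small]
  · have key : ∃ d, ((d = c ∧ r + 1 = r + 1) ∨ (d = r ∧ r + 1 = r + 1) ∨ (d, r + 1) ∈ A ∨
        (d, r + 1) ∈ B) ∧ f (d + 1) ≤ f d := by
      rcases c3 with c3 | c3
      · exact ⟨c, .inl ⟨rfl, rfl⟩, c3⟩
      · exact ⟨r, .inr (.inl ⟨rfl, rfl⟩), c3⟩
    rintro s e (⟨rfl, rfl⟩ | ⟨rfl, rfl⟩ | hs | hs)
    · exact key
    · exact key
    · obtain ⟨d, hd, hd'⟩ := hA.descentHook s e hs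
      exact ⟨d, .inr (.inr (.inl hd)), hd'⟩
    · obtain ⟨d, hd, hd'⟩ := hB.descentHook s e hs
      exact ⟨d, .inr (.inr (.inr hd)), hd'⟩
  · rintro s e s' e' (⟨rfl, rfl⟩ | ⟨rfl, rfl⟩ | hs | hs) (⟨rfl, rfl⟩ | ⟨rfl, rfl⟩ | hs' | hs') hlt
    all_goals first
      | exact hA.nested _ _ _ _ hs hs' hlt
      | exact hB.nested _ _ _ _ hs hs' hlt
      | skip
    all_goals first
      | have := bA _ _ hs
      | have := bB _ _ hs
      | skip
    all_goals first
      | have := bA _ _ hs'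
      | have := bB _ _ hs'
      | skip
    all_goals omega
  · grind [hA.binary, hB.binary]
  · grind [hA.edge, hB.edge]

/-- The long hook ending at `r` separates the others: nesting forbids crossing its southwest
endpoint, and the binary condition forbids a second long hook to `r`. -/
theorem Valid.exists_join (h : Valid Q f l (r + 1) S) (hlc : l < c) (hcr : c < r)
    (hS : (c - 1, r) ∈ S) : ∃ A B, Valid Q f l c A ∧ Valid Q f c r B ∧ Joinable Q f c r ∧
      joinHooks c r A B = S := by
  obtain ⟨r, rfl⟩ : ∃ k, r = k + 1 := ⟨r - 1, by omega⟩
  obtain ⟨c, rfl⟩ : ∃ k, c = k + 1 := ⟨c - 1, by omega⟩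
  simp only [Nat.add_sub_cancel] at hS
  have hS' := h.small _ _ hS
  simp only [Nat.add_sub_cancel] at hS'
  have hb := h.bounds
  -- Every hook is one of the two ending at the last point, or lies entirely in one of the two
  -- halves. After the shift of indices the halves are `[l, c + 1)` and `[c + 1, r + 1)`.
  have hsplit : ∀ s e, (s, e) ∈ S → (s = c ∧ e = r + 1) ∨ (s = r ∧ e = r + 1) ∨
      (e < c + 1) ∨ (c + 1 ≤ s ∧ e < r + 1) := by
    intro s e hs
    obtain ⟨b1, b2, b3, b4⟩ := hb s e hs
    rcases lt_trichotomy s c with h1 | h1 | h1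
    · rcases h.nested _ _ _ _ hs hS h1 with h2 | h2
      · omega
      · obtain rfl : e = r + 1 := by omega
        have := h.binary _ _ _ hs hS (by omega) (by omega)
        omega
    · subst h1
      have := h.unique _ _ _ hs hS
      omega
    · rcases Nat.lt_or_ge e (r + 1) with h2 | h2
      · omega
      · obtain rfl : e = r + 1 := by omega
        by_contra h3
        have := h.binary _ _ _ hs hS (by omega) (by omega)
        omega
  refine ⟨S.filter fun p => p.2 < c + 1, S.filter fun p => c + 1 ≤ p.1 ∧ p.2 < r + 1,
    ?_, ?_, ?_, ?_⟩
  · constructor <;> simp only [Finset.mem_filter]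
    · grind
    · grind [h.unique]
    · intro d h1 h2 h3
      obtain ⟨e, he⟩ := h.descent d h1 (by omega) h3
      have := hsplit d e he
      have := hb d e he
      exact ⟨e, he, by omega⟩
    · grind [h.small]
    · rintro s e ⟨hs, hs'⟩
      obtain ⟨d, hd, hd'⟩ := h.descentHook s e hs
      exact ⟨d, ⟨hd, hs'⟩, hd'⟩
    · exact fun s e s' e' hs hs' => h.nested _ _ _ _ hs.1 hs'.1
    · grind [h.binary]
    · grind [h.edge]
  · constructor <;> simp only [Finset.mem_filter]
    · grind
    · grind [h.unique]
    · intro d h1 h2 h3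
      obtain ⟨e, he⟩ := h.descent d (by omega) (by omega) h3
      have := hsplit d e he
      have := hb d e he
      exact ⟨e, he, by omega⟩
    · rintro s e ⟨hs, hs'⟩
      have := hb s e hs
      exact ⟨h.small s e hs, by omega⟩
    · rintro s e ⟨hs, hs'⟩
      obtain ⟨d, hd, hd'⟩ := h.descentHook s e hs
      have := hsplit d e hd
      have := hb s e hs
      exact ⟨d, ⟨hd, by omega⟩, hd'⟩
    · exact fun s e s' e' hs hs' => h.nested _ _ _ _ hs.1 hs'.1
    · grind [h.binary]
    · grind [h.edge]
  · refine ⟨(hb _ _ hS).2.2.2, (hb _ _ hS').2.2.2, ?_, h.edge _ _ hS (by omega)⟩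
    -- Only two hooks end at the last point, so the descent hook required there is one of them. This
    -- is the disjunction in `Joinable`.
    obtain ⟨d, hd, hd'⟩ := h.descentHook _ _ hS
    have := hsplit d _ hd
    have := hb _ _ hd
    obtain rfl | rfl : d = c ∨ d = r := by omega
    · exact .inl hd'
    · exact .inr hd'
  · ext ⟨s, e⟩
    simp only [mem_join, Nat.add_sub_cancel, Finset.mem_filter]
    constructor
    · grind
    · intro hs
      have := hsplit s e hs
      tauto

end Configurations

/-! ### Colors, weights and the recursion for weighted sums -/

section Weights

variable {α : Type*} [LinearOrder α]
variable {Q : α → α → α → Prop} {f : ℕ → α} {l r c : ℕ} {S A B : Finset (ℕ × ℕ)}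

theorem Valid.cases_succ (h : Valid Q f l (r + 1) S) (hlr : l ≤ r) :
    (Valid Q f l r S ∧ (l = r ∨ f (r - 1) < f r)) ∨
    (∃ A, Valid Q f l r A ∧ l < r ∧ f (r - 1) = f r ∧ insert (r - 1, r) A = S) ∨
    ∃ c A B, l < c ∧ c < r ∧ Valid Q f l c A ∧ Valid Q f c r B ∧ Joinable Q f c r ∧
      joinHooks c r A B = S := by
  by_cases h1 : ∀ s, (s, r) ∉ S
  · exact .inl ((valid_succ_iff_of_forall_notMem h1 hlr).1 h)
  push Not at h1
  obtain ⟨s, hs⟩ := h1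
  have hs' := h.small _ _ hs
  by_cases h2 : ∀ s, (s, r) ∈ S → s = r - 1
  · obtain ⟨h3, h4, h5⟩ := h.erase_small hs' h2
    exact .inr (.inl ⟨_, h3, h4, h5, Finset.insert_erase hs'⟩)
  push Not at h2
  obtain ⟨s', hs', hne⟩ := h2
  have := h.bounds _ _ hs'
  obtain ⟨A, B, h3⟩ := h.exists_join (c := s' + 1) (by omega) (by omega) hs'
  exact .inr (.inr ⟨s' + 1, A, B, by omega, by omega, h3⟩)

/-- In each case of the decomposition, the last letter dominates the last letters of the shorter
intervals. Hence a long hook to `r` lies above every point between its endpoints, and the height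
condition in the coloring has no effect there. -/
theorem Valid.letter_le_last (h : Valid Q f l r S) {i : ℕ} (hl : l ≤ i) (hr : i < r) :
    f i ≤ f (r - 1) := by
  induction r using Nat.strong_induction_on generalizing l S with
  | _ r ih =>
    obtain ⟨r, rfl⟩ : ∃ k, r = k + 1 := ⟨r - 1, by omega⟩
    simp only [Nat.add_sub_cancel]
    rcases Nat.eq_or_lt_of_le (Nat.le_of_lt_succ hr) with rfl | hir
    · exact le_rfl
    rcases h.cases_succ (by omega) with ⟨h1, h2⟩ | ⟨A, h1, -, h2, -⟩ |
      ⟨c, A, B, hlc, hcr, hA, hB, hJ, -⟩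
    · have := ih r (by omega) h1 hl hir
      rcases h2 with h2 | h2
      · omega
      · exact this.trans h2.le
    · exact (ih r (by omega) h1 hl hir).trans h2.le
    · rcases Nat.lt_or_ge i c with hic | hic
      · exact (ih c (by omega) hA hl hic).trans hJ.1
      · exact (ih r (by omega) hB hic hir).trans hJ.2.1

/-- The point at position `i` sees the hook `h`. -/
def Sees (f : ℕ → α) (i : ℕ) (h : ℕ × ℕ) : Prop :=
  (h.1 < i ∧ i < h.2 ∧ f i ≤ f h.2) ∨ h.2 = i

open Classical in
/-- The number of positions in `[l, r)` that see no hook. -/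
noncomputable def skyCount (f : ℕ → α) (l r : ℕ) (S : Finset (ℕ × ℕ)) : ℕ :=
  {i ∈ Finset.Ico l r | ∀ h ∈ S, ¬ Sees f i h}.card

open Classical in
/-- The number of positions in `[l, r)` for which `h` is the hook seen with the rightmost
southwest endpoint. -/
noncomputable def hookCount (f : ℕ → α) (l r : ℕ) (S : Finset (ℕ × ℕ)) (h : ℕ × ℕ) : ℕ :=
  {i ∈ Finset.Ico l r | Sees f i h ∧ ∀ h' ∈ S, Sees f i h' → h'.1 ≤ h.1}.card

/-- The product of the Catalan numbers of the hook colors. -/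
noncomputable def hookWeight (f : ℕ → α) (l r : ℕ) (S : Finset (ℕ × ℕ)) : ℕ :=
  ∏ h ∈ S, catalan (hookCount f l r S h)

theorem Valid.not_sees (hS : Valid Q f l r S) {i : ℕ} (hi : i < l ∨ r ≤ i) :
    ∀ h ∈ S, ¬ Sees f i h := by
  rintro ⟨s, e⟩ h
  have := hS.bounds _ _ h
  simp only [Sees]
  omega

theorem skyCount_succ_of_valid (h : Valid Q f l r S) (hlr : l ≤ r) :
    skyCount f l (r + 1) S = skyCount f l r S + 1 := by
  classical
  rw [skyCount, skyCount, ← Finset.insert_Ico_right_eq_Ico_add_one hlr, Finset.filter_insert,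
    if_pos (h.not_sees (.inr le_rfl)), Finset.card_insert_of_notMem (by simp)]

theorem hookWeight_succ_of_valid (h : Valid Q f l r S) (hlr : l ≤ r) :
    hookWeight f l (r + 1) S = hookWeight f l r S := by
  classical
  refine Finset.prod_congr rfl fun p hp => ?_
  rw [hookCount, hookCount, ← Finset.insert_Ico_right_eq_Ico_add_one hlr, Finset.filter_insert,
    if_neg fun h' => h.not_sees (.inr le_rfl) p hp h'.1]

theorem skyCount_insert_small :
    skyCount f l (r + 1) (insert (r - 1, r) S) = skyCount f l r S := by
  classical
  rw [skyCount, skyCount]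
  congr 1
  ext i
  simp only [Finset.mem_filter, Finset.mem_Ico, Finset.forall_mem_insert]
  have : Sees f i (r - 1, r) ↔ i = r := by simp only [Sees]; omega
  rw [this]
  constructor
  · rintro ⟨h1, h2, h3⟩
    exact ⟨by omega, h3⟩
  · rintro ⟨h1, h3⟩
    exact ⟨by omega, by omega, h3⟩

theorem hookWeight_insert_small (h : Valid Q f l r S) (hlr : l < r) :
    hookWeight f l (r + 1) (insert (r - 1, r) S) = hookWeight f l r S := by
  classical
  have hs : ∀ i, Sees f i (r - 1, r) ↔ i = r := fun i => by simp only [Sees]; omega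
  rw [hookWeight, Finset.prod_insert (h.notMem_ne le_rfl)]
  have h1 : hookCount f l (r + 1) (insert (r - 1, r) S) (r - 1, r) = 1 := by
    rw [hookCount, Finset.card_eq_one]
    refine ⟨r, ?_⟩
    ext i
    simp only [Finset.mem_filter, Finset.mem_Ico, hs, Finset.mem_singleton,
      Finset.forall_mem_insert]
    constructor
    · exact fun h => h.2.1
    · rintro rfl
      exact ⟨by omega, rfl, fun _ => le_rfl,
        fun p hp hp' => absurd hp' (h.not_sees (.inr le_rfl) p hp)⟩
  rw [h1, catalan_one, one_mul]
  refine Finset.prod_congr rfl fun p hp => ?_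
  rw [hookCount, hookCount]
  congr 2
  ext i
  simp only [Finset.mem_filter, Finset.mem_Ico, hs, Finset.forall_mem_insert]
  constructor
  · rintro ⟨h1, h2, h3, h4⟩
    have : i ≠ r := by
      rintro rfl
      exact h.not_sees (.inr le_rfl) p hp h2
    exact ⟨by omega, h2, h4⟩
  · rintro ⟨h1, h2, h4⟩
    exact ⟨by omega, h2, fun _ => by omega, h4⟩

/-- The parameter `P` lets one description of the visible hooks serve both for counting sky points
(`P` false) and for comparing southwest endpoints. -/
theorem Valid.forall_join_sees (hA : Valid Q f l c A) (hB : Valid Q f c r B) (hlc : l < c)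
    (hcr : c < r) (hc : Joinable Q f c r) {i : ℕ} (P : ℕ × ℕ → Prop) :
    (∀ h ∈ joinHooks c r A B, Sees f i h → P h) ↔
      (i < c → ∀ h ∈ A, Sees f i h → P h) ∧
      (c ≤ i → i < r → P (c - 1, r) ∧ ∀ h ∈ B, Sees f i h → P h) ∧
      (i = r → P (c - 1, r) ∧ P (r - 1, r)) := by
  have hsr : Sees f i (r - 1, r) ↔ i = r := by simp only [Sees]; omega
  have hsc : Sees f i (c - 1, r) ↔ c ≤ i ∧ i ≤ r := by
    simp only [Sees]
    constructor
    · omega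
    · rintro ⟨h1, h2⟩
      rcases Nat.eq_or_lt_of_le h2 with h2 | h2
      · exact .inr h2.symm
      · exact .inl ⟨by omega, h2, (hB.letter_le_last h1 h2).trans hc.2.1⟩
  have hA' : ∀ h ∈ A, Sees f i h → i < c := fun h hh hs => by
    by_contra hi
    exact hA.not_sees (.inr (by omega)) h hh hs
  have hB' : ∀ h ∈ B, Sees f i h → c ≤ i ∧ i < r := fun h hh hs => by
    by_contra hi
    exact hB.not_sees (by omega) h hh hs
  simp only [joinHooks, Finset.forall_mem_insert, Finset.mem_union, hsr, hsc]
  constructor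
  · rintro ⟨h1, h2, h3⟩
    exact ⟨fun _ h hh => h3 h (.inl hh),
      fun hi hi' => ⟨h1 ⟨hi, hi'.le⟩, fun h hh => h3 h (.inr hh)⟩,
      fun hi => ⟨h1 (by omega), h2 hi⟩⟩
  · rintro ⟨h1, h2, h3⟩
    refine ⟨fun hi => ?_, fun hi => (h3 hi).2, fun h hh hs => ?_⟩
    · rcases Nat.eq_or_lt_of_le hi.2 with hi' | hi'
      · exact (h3 hi').1
      · exact (h2 hi.1 hi').1
    · rcases hh with hh | hh
      · exact h1 (hA' h hh hs) h hh hs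
      · exact (h2 (hB' h hh hs).1 (hB' h hh hs).2).2 h hh hs

theorem skyCount_join (hA : Valid Q f l c A) (hB : Valid Q f c r B) (hlc : l < c)
    (hcr : c < r) (hc : Joinable Q f c r) :
    skyCount f l (r + 1) (joinHooks c r A B) = skyCount f l c A := by
  classical
  rw [skyCount, skyCount]
  congr 1
  ext i
  simp only [Finset.mem_filter, Finset.mem_Ico]
  have := hA.forall_join_sees hB hlc hcr hc (i := i) fun _ => False
  simp only [imp_false, false_and] at this
  rw [this]
  constructor
  · rintro ⟨h1, h2, h3, h4⟩
    exact ⟨by omega, h2 (by omega)⟩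
  · rintro ⟨h1, h2⟩
    exact ⟨by omega, fun _ => h2, by omega, by omega⟩

/-- The point `r` takes the color of the small hook, which contributes `C_1 = 1`. The long hook
colors exactly the former sky points of `[c, r)`, because any hook of `B` starts further right and
takes precedence. -/
theorem hookWeight_join (hA : Valid Q f l c A) (hB : Valid Q f c r B) (hlc : l < c)
    (hcr : c < r) (hc : Joinable Q f c r) :
    hookWeight f l (r + 1) (joinHooks c r A B) =
      hookWeight f l c A * (hookWeight f c r B * catalan (skyCount f c r B)) := by
  classical
  have hd : Disjoint A B := by
    rw [Finset.disjoint_left]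
    rintro ⟨s, e⟩ h1 h2
    have := hA.bounds _ _ h1
    have := hB.bounds _ _ h2
    omega
  have hr : (r - 1, r) ∉ A ∪ B := by
    rw [Finset.mem_union, not_or]
    exact ⟨hA.notMem_ne hcr.le, hB.notMem_ne le_rfl⟩
  have hc' : (c - 1, r) ∉ insert (r - 1, r) (A ∪ B) := by
    rw [Finset.mem_insert, Finset.mem_union, not_or, not_or]
    refine ⟨?_, hA.notMem_ne hcr.le, hB.notMem_ne le_rfl⟩
    simp only [Prod.mk.injEq]
    omega
  have key := fun i => hA.forall_join_sees hB hlc hcr hc (i := i)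
  have e1 : hookCount f l (r + 1) (joinHooks c r A B) (r - 1, r) = 1 := by
    rw [hookCount, Finset.card_eq_one]
    refine ⟨r, ?_⟩
    ext i
    have hs : Sees f i (r - 1, r) ↔ i = r := by simp only [Sees]; omega
    simp only [Finset.mem_filter, Finset.mem_Ico, key, Finset.mem_singleton, hs]
    constructor
    · exact fun h => h.2.1
    · rintro rfl
      exact ⟨by omega, rfl, by omega, by omega, fun _ => ⟨by omega, le_rfl⟩⟩
  have e2 : hookCount f l (r + 1) (joinHooks c r A B) (c - 1, r) = skyCount f c r B := by
    rw [hookCount, skyCount]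
    congr 1
    ext i
    simp only [Finset.mem_filter, Finset.mem_Ico, key]
    constructor
    · rintro ⟨h1, h2, h3, h4, h5⟩
      have hi : c ≤ i ∧ i < r := by
        simp only [Sees] at h2
        omega
      refine ⟨hi, fun h hh hs => ?_⟩
      have := (h4 hi.1 hi.2).2 h hh hs
      have := hB.bounds h.1 h.2 hh
      omega
    · rintro ⟨h1, h2⟩
      refine ⟨by omega, .inl ⟨by omega, h1.2, (hB.letter_le_last h1.1 h1.2).trans hc.2.1⟩,
        by omega, fun _ _ => ⟨le_rfl, fun h hh hs => absurd hs (h2 h hh)⟩, by omega⟩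
  have e3 : ∀ p ∈ A, hookCount f l (r + 1) (joinHooks c r A B) p = hookCount f l c A p := by
    intro p hp
    rw [hookCount, hookCount]
    congr 1
    ext i
    simp only [Finset.mem_filter, Finset.mem_Ico, key]
    constructor
    · rintro ⟨h1, h2, h3, h4, h5⟩
      have hi : i < c := by
        by_contra hi
        exact hA.not_sees (.inr (by omega)) p hp h2
      exact ⟨by omega, h2, h3 hi⟩
    · rintro ⟨h1, h2, h3⟩
      exact ⟨by omega, h2, fun _ => h3, by omega, by omega⟩
  have e4 : ∀ p ∈ B, hookCount f l (r + 1) (joinHooks c r A B) p = hookCount f c r B p := by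
    intro p hp
    have hb := hB.bounds p.1 p.2 hp
    rw [hookCount, hookCount]
    congr 1
    ext i
    simp only [Finset.mem_filter, Finset.mem_Ico, key]
    constructor
    · rintro ⟨h1, h2, h3, h4, h5⟩
      have hi : c ≤ i ∧ i < r := by
        by_contra hi
        exact hB.not_sees (by omega) p hp h2
      exact ⟨hi, h2, (h4 hi.1 hi.2).2⟩
    · rintro ⟨h1, h2, h3⟩
      exact ⟨by omega, h2, by omega, fun _ _ => ⟨by omega, h3⟩, by omega⟩
  rw [hookWeight]
  conv_lhs => rw [joinHooks, Finset.prod_insert hc', Finset.prod_insert hr, Finset.prod_union hd]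
  rw [← joinHooks, e1, e2, catalan_one, Finset.prod_congr rfl fun p hp => congrArg catalan (e3 p hp),
    Finset.prod_congr rfl fun p hp => congrArg catalan (e4 p hp), ← hookWeight, ← hookWeight]
  ring

open Classical in
/-- The valid configurations of `[l, r)`. -/
noncomputable def configs (Q : α → α → α → Prop) (f : ℕ → α) (l r : ℕ) :
    Finset (Finset (ℕ × ℕ)) :=
  {S ∈ (Finset.range r ×ˢ Finset.range r).powerset | Valid Q f l r S}

theorem mem_configs : S ∈ configs Q f l r ↔ Valid Q f l r S := by
  simp only [configs, Finset.mem_filter, Finset.mem_powerset, and_iff_right_iff_imp]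
  rintro h ⟨s, e⟩ hs
  have := h.bounds _ _ hs
  simp only [Finset.mem_product, Finset.mem_range]
  omega

/-- The sum over the valid configurations of `[l, r)` of their weights, where the sky contributes
`g` of its number of points. -/
noncomputable def configSum (Q : α → α → α → Prop) (f : ℕ → α) (l r : ℕ) (g : ℕ → ℕ) : ℕ :=
  ∑ S ∈ configs Q f l r, hookWeight f l r S * g (skyCount f l r S)

theorem configSum_self (g : ℕ → ℕ) : configSum Q f l l g = g 0 := by
  have : configs Q f l l = {∅} := by
    ext S
    rw [mem_configs, valid_self_iff, Finset.mem_singleton]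
  simp [configSum, this, hookWeight, skyCount]

theorem configSum_eq_zero {i : ℕ} (hl : l ≤ i) (hr : i < r) (hi : f (r - 1) < f i) (g : ℕ → ℕ) :
    configSum Q f l r g = 0 := by
  refine Finset.sum_eq_zero fun S hS => ?_
  exact absurd ((mem_configs.1 hS).letter_le_last hl hr) (not_le.2 hi)

theorem mem_ite_empty {β : Type*} {p : Prop} [Decidable p] {s : Finset β} {x : β} :
    x ∈ (if p then s else ∅) ↔ p ∧ x ∈ s := by
  split_ifs with h <;> simp [h]

open Classical in
theorem configs_succ (hlr : l ≤ r) :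
    configs Q f l (r + 1) =
      (if l = r ∨ f (r - 1) < f r then configs Q f l r else ∅) ∪
      ((if l < r ∧ f (r - 1) = f r then (configs Q f l r).image (insert (r - 1, r)) else ∅) ∪
      {c ∈ Finset.Ioo l r | Joinable Q f c r}.biUnion fun c =>
        (configs Q f l c ×ˢ configs Q f c r).image fun p => joinHooks c r p.1 p.2) := by
  ext S
  simp only [Finset.mem_union, Finset.mem_biUnion, Finset.mem_filter, Finset.mem_Ioo,
    Finset.mem_image, Finset.mem_product, mem_ite_empty, mem_configs, Prod.exists]
  constructor
  · intro h
    rcases h.cases_succ hlr with ⟨h1, h2⟩ | ⟨A, h1, h2, h3, h4⟩ |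
      ⟨c, A, B, hlc, hcr, hA, hB, hJ, h⟩
    · exact .inl ⟨h2, h1⟩
    · exact .inr (.inl ⟨⟨h2, h3⟩, A, h1, h4⟩)
    · exact .inr (.inr ⟨c, ⟨⟨hlc, hcr⟩, hJ⟩, A, B, ⟨hA, hB⟩, h⟩)
  · rintro (⟨h1, h2⟩ | ⟨⟨h1, h2⟩, A, hA, rfl⟩ | ⟨c, ⟨⟨h1, h2⟩, h3⟩, A, B, ⟨hA, hB⟩, rfl⟩)
    · exact (valid_succ_iff_of_forall_notMem (fun s => h2.notMem_ne le_rfl) hlr).2 ⟨h2, h1⟩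
    · exact hA.insert_small h1 h2
    · exact hA.join hB h1 h2 h3

theorem join_injOn {A' B' : Finset (ℕ × ℕ)} (hA : Valid Q f l c A) (hB : Valid Q f c r B)
    (hA' : Valid Q f l c A') (hB' : Valid Q f c r B') (hcr : c < r)
    (h : joinHooks c r A B = joinHooks c r A' B') : A = A' ∧ B = B' := by
  have aux : ∀ {A B : Finset (ℕ × ℕ)}, Valid Q f l c A → Valid Q f c r B →
      A = (joinHooks c r A B).filter (fun p => p.2 < c) ∧
      B = (joinHooks c r A B).filter (fun p => c ≤ p.1 ∧ p.2 < r) := by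
    intro A B hA hB
    have bA := hA.bounds
    have bB := hB.bounds
    constructor
    all_goals
      ext ⟨s, e⟩
      simp only [Finset.mem_filter, mem_join]
      constructor
    · exact fun hs => ⟨.inr (.inr (.inl hs)), (bA _ _ hs).2.2.1⟩
    · rintro ⟨h | h | h | h, h'⟩
      · omega
      · omega
      · exact h
      · have := bB _ _ h
        omega
    · exact fun hs => ⟨.inr (.inr (.inr hs)), (bB _ _ hs).1, (bB _ _ hs).2.2.1⟩
    · rintro ⟨h | h | h | h, h'⟩
      · omega
      · omega
      · have := bA _ _ h
        omega
      · exact h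
  constructor
  · rw [(aux hA hB).1, h, ← (aux hA' hB').1]
  · rw [(aux hA hB).2, h, ← (aux hA' hB').2]

-- The sky weight `g` is arbitrary because adding an uncolored point shifts it. In a join, the right
-- factor always carries `catalan`, supplied by the long hook.
open Classical in
theorem configSum_succ (hlr : l ≤ r) (g : ℕ → ℕ) :
    configSum Q f l (r + 1) g =
      (if l = r ∨ f (r - 1) < f r then configSum Q f l r (fun m => g (m + 1)) else 0) +
      ((if l < r ∧ f (r - 1) = f r then configSum Q f l r g else 0) +
      ∑ c ∈ Finset.Ioo l r,
        if Joinable Q f c r then configSum Q f l c g * configSum Q f c r catalan else 0) := by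
  have hins : ∀ A ∈ configs Q f l r, (r - 1, r) ∉ A := fun A hA =>
    (mem_configs.1 hA).notMem_ne le_rfl
  rw [configSum, configs_succ hlr, Finset.sum_union, Finset.sum_union, Finset.sum_biUnion,
    Finset.sum_filter]
  · congr 1
    · split_ifs with h
      · refine Finset.sum_congr rfl fun S hS => ?_
        rw [mem_configs] at hS
        rw [hookWeight_succ_of_valid hS hlr, skyCount_succ_of_valid hS hlr]
      · rfl
    congr 1
    · split_ifs with h
      · rw [Finset.sum_image]
        · refine Finset.sum_congr rfl fun S hS => ?_
          rw [mem_configs] at hS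
          rw [hookWeight_insert_small hS h.1, skyCount_insert_small]
        · intro A hA B hB hAB
          rw [← Finset.erase_insert (hins A hA), ← Finset.erase_insert (hins B hB), hAB]
      · rfl
    · refine Finset.sum_congr rfl fun c hc => ?_
      rw [Finset.mem_Ioo] at hc
      split_ifs with h
      · rw [Finset.sum_image, configSum, configSum, Finset.sum_mul_sum, ← Finset.sum_product']
        · refine Finset.sum_congr rfl fun p hp => ?_
          rw [Finset.mem_product, mem_configs, mem_configs] at hp
          rw [hookWeight_join hp.1 hp.2 hc.1 hc.2 h, skyCount_join hp.1 hp.2 hc.1 hc.2 h]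
          ring
        · rintro p hp p' hp' hpp
          simp only [Finset.coe_product, Set.mem_prod, Finset.mem_coe, mem_configs] at hp hp'
          have := join_injOn hp.1 hp.2 hp'.1 hp'.2 hc.2 hpp
          exact Prod.ext this.1 this.2
      · rfl
  · intro c hc c' hc' hne
    rw [Function.onFun, Finset.disjoint_left]
    simp only [Finset.coe_filter, Finset.mem_Ioo, Set.mem_ofPred_eq] at hc hc'
    simp only [Finset.mem_image, Finset.mem_product, mem_configs, Prod.exists]
    rintro _ ⟨A, B, ⟨hA, hB⟩, rfl⟩ ⟨A', B', ⟨hA', hB'⟩, hj⟩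
    -- In a join, the hooks ending at `r` start at the cut or at `r - 1`, so the configuration
    -- determines its cut.
    have h1 : (c - 1, r) ∈ joinHooks c' r A' B' := by
      rw [hj, mem_join]
      simp
    rw [mem_join] at h1
    rcases h1 with h1 | h1 | h1 | h1
    · omega
    · omega
    · exact hA'.notMem_ne hc'.1.2.le h1
    · exact hB'.notMem_ne le_rfl h1
  · rw [Finset.disjoint_left]
    simp only [Finset.mem_biUnion, Finset.mem_filter, Finset.mem_Ioo, mem_ite_empty,
      Finset.mem_image, Finset.mem_product, mem_configs, Prod.exists]
    rintro _ ⟨-, A, hA, rfl⟩ ⟨c, ⟨hc, -⟩, A', B', -, h⟩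
    have h1 : (c - 1, r) ∈ insert (r - 1, r) A := by
      rw [← h, mem_join]
      simp
    rw [Finset.mem_insert, Prod.mk.injEq] at h1
    rcases h1 with h1 | h1
    · omega
    · exact hA.notMem_ne le_rfl h1
  · rw [Finset.disjoint_left]
    simp only [Finset.mem_union, Finset.mem_biUnion, Finset.mem_filter, Finset.mem_Ioo,
      mem_ite_empty, Finset.mem_image, Finset.mem_product, Prod.exists]
    rintro S ⟨-, hS⟩ (⟨-, A, hA, rfl⟩ | ⟨c, -, A', B', -, rfl⟩)
    · exact hins _ hS (Finset.mem_insert_self _ _)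
    · exact hins _ hS (mem_join.2 (.inr (.inl ⟨rfl, rfl⟩)))

end Weights

/-! ### Cutting at a sky point and the Catalan recursion -/

section Recursion

variable {α : Type*} [LinearOrder α]
variable {Q : α → α → α → Prop} {f : ℕ → α} {l r c : ℕ}

/-- The Cauchy product of two sequences. -/
def conv (g h : ℕ → ℕ) (m : ℕ) : ℕ := ∑ p ∈ Finset.HasAntidiagonal.antidiagonal m, g p.1 * h p.2

theorem conv_succ (g h : ℕ → ℕ) (m : ℕ) :
    conv g h (m + 1) = conv g (fun j => h (j + 1)) m + g (m + 1) * h 0 := by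
  rw [conv, Finset.Nat.sum_antidiagonal_succ', add_comm, conv]

theorem configSum_add (a b : ℕ → ℕ) :
    configSum Q f l r (fun m => a m + b m) = configSum Q f l r a + configSum Q f l r b := by
  simp only [configSum, mul_add, Finset.sum_add_distrib]

theorem configSum_mul_const (a : ℕ → ℕ) (k : ℕ) :
    configSum Q f l r (fun m => a m * k) = configSum Q f l r a * k := by
  simp only [configSum, Finset.sum_mul, mul_assoc]

theorem configSum_singleton (g : ℕ → ℕ) : configSum Q f l (l + 1) g = g 1 := by
  rw [configSum_succ le_rfl]
  simp [configSum_self]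

/-- A Cauchy product splits the sky points into an initial group weighted by `g` and a final group
weighted by `h`. The index `c` is the first point of the final group; being a sky point it ends no
hook, so it is the left end or is preceded by a smaller letter. The last summand is the case of an
empty final group. The proof is by induction, removing the last letter on both sides. -/
theorem configSum_conv (hlr : l ≤ r) (g h : ℕ → ℕ) :
    configSum Q f l r (conv g h) =
      ∑ c ∈ Finset.Ico l r,
        (if c = l ∨ f (c - 1) < f c then configSum Q f l c g * configSum Q f c r h else 0) +
      configSum Q f l r g * h 0 := by
  classical
  induction r using Nat.strong_induction_on generalizing g h with
  | _ r ih =>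
  rcases Nat.eq_or_lt_of_le hlr with rfl | hlr
  · simp [configSum_self, conv]
  obtain ⟨r, rfl⟩ : ∃ k, r = k + 1 := ⟨r - 1, by omega⟩
  rw [Finset.sum_Ico_succ_top (by omega), configSum_singleton]
  rcases Nat.eq_or_lt_of_le (Nat.le_of_lt_succ hlr) with rfl | hlr
  · rw [configSum_singleton, configSum_singleton, configSum_self, conv_succ]
    simp [conv]
  -- Only the left part of a join keeps its sky points. The cut `c` therefore precedes the joining
  -- point `e`, and the two sums can be exchanged.
  have hI : (∑ e ∈ Finset.Ioo l r, if Joinable Q f e r then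
        configSum Q f l e (conv g h) * configSum Q f e r catalan else 0) =
      (∑ c ∈ Finset.Ico l r, if c = l ∨ f (c - 1) < f c then configSum Q f l c g *
        ∑ e ∈ Finset.Ioo c r, (if Joinable Q f e r then
          configSum Q f c e h * configSum Q f e r catalan else 0) else 0) +
      (∑ e ∈ Finset.Ioo l r, if Joinable Q f e r then
        configSum Q f l e g * configSum Q f e r catalan else 0) * h 0 := by
    simp only [Finset.mul_sum, Finset.sum_mul, ← Finset.sum_filter (s := Finset.Ico l r)]
    rw [Finset.sum_comm' (t' := Finset.Ioo l r)
      (s' := fun e => {c ∈ Finset.Ico l e | c = l ∨ f (c - 1) < f c}), ← Finset.sum_add_distrib]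
    · refine Finset.sum_congr rfl fun e he => ?_
      rw [Finset.mem_Ioo] at he
      split_ifs with hJ
      · rw [ih e (by omega) he.1.le, ← Finset.sum_filter, add_mul, Finset.sum_mul]
        congr 1
        · exact Finset.sum_congr rfl fun _ _ => by ring
        · ring
      · simp
    · intro c e
      simp only [Finset.mem_filter, Finset.mem_Ico, Finset.mem_Ioo]
      constructor
      · rintro ⟨⟨h1, h2⟩, h3⟩
        exact ⟨⟨by omega, h2⟩, by omega⟩
      · rintro ⟨⟨h1, h2⟩, h3⟩
        exact ⟨⟨by omega, h2⟩, by omega⟩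
  have hC : ∀ c ∈ Finset.Ico l r, (if c = l ∨ f (c - 1) < f c then
      configSum Q f l c g * configSum Q f c (r + 1) h else 0) =
      (if f (r - 1) < f r then if c = l ∨ f (c - 1) < f c then
        configSum Q f l c g * configSum Q f c r (fun m => h (m + 1)) else 0 else 0) +
      ((if f (r - 1) = f r then if c = l ∨ f (c - 1) < f c then
        configSum Q f l c g * configSum Q f c r h else 0 else 0) +
      if c = l ∨ f (c - 1) < f c then configSum Q f l c g *
        ∑ e ∈ Finset.Ioo c r, (if Joinable Q f e r then
          configSum Q f c e h * configSum Q f e r catalan else 0) else 0) := by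
    intro c hc
    rw [Finset.mem_Ico] at hc
    rw [configSum_succ hc.2.le]
    have h1 : c ≠ r := by omega
    have h2 : c < r := hc.2
    simp only [h1, h2, false_or, true_and]
    split_ifs <;> ring
  rw [configSum_succ hlr.le, configSum_succ hlr.le, hI, Finset.sum_congr rfl hC,
    Finset.sum_add_distrib, Finset.sum_add_distrib]
  have h1 : l ≠ r := by omega
  have h1' : r ≠ l := by omega
  simp only [h1, h1', hlr, false_or, true_and]
  have e1 : configSum Q f l r (fun m => conv g h (m + 1)) =
      configSum Q f l r (conv g fun j => h (j + 1)) +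
        configSum Q f l r (fun m => g (m + 1)) * h 0 := by
    simp only [conv_succ]
    rw [configSum_add, configSum_mul_const]
  rw [e1, ih r (by omega) hlr.le, ih r (by omega) hlr.le]
  rcases lt_trichotomy (f (r - 1)) (f r) with hf | hf | hf
  · simp only [hf, if_true, hf.ne, if_false, Finset.sum_const_zero]
    ring
  · simp only [hf, if_true, lt_irrefl, if_false, Finset.sum_const_zero]
    ring
  · simp only [hf.ne', hf.not_gt, if_false, Finset.sum_const_zero]
    ring

theorem conv_catalan : conv catalan catalan = fun m => catalan (m + 1) := by
  funext m
  rw [catalan_succ', conv]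

/-- `pa` and `pb` are the relations required of the letters in the left and right subtrees with
respect to the letter at the root, and `Q` is the induced condition on pairs of hooks. -/
structure IsChildRule (pa pb : α → α → Prop) (Q : α → α → α → Prop) : Prop where
  left_of_lt : ∀ {x z}, x < z → pa x z
  right_of_lt : ∀ {x z}, x < z → pb x z
  le_of_left : ∀ {x z}, pa x z → x ≤ z
  le_of_right : ∀ {x z}, pb x z → x ≤ z
  left_iff : ∀ {z}, pa z z ↔ ¬ pb z z
  iff_of_lt : ∀ {x y z}, y < z → x ≤ z → (Q x y z ↔ pa x z)
  iff_of_eq : ∀ {x z}, x ≤ z → (Q x z z ↔ pa x z ∧ pb z z)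

theorem isChildRule_lt_le :
    IsChildRule (α := α) (· < ·) (· ≤ ·) (fun x _ z => x < z) where
  left_of_lt h := h
  right_of_lt h := h.le
  le_of_left h := h.le
  le_of_right h := h
  left_iff := by simp
  iff_of_lt _ _ := Iff.rfl
  iff_of_eq _ := by simp

theorem isChildRule_le_lt :
    IsChildRule (α := α) (· ≤ ·) (· < ·) (fun _ y z => y < z) where
  left_of_lt h := h.le
  right_of_lt h := h
  le_of_left h := h
  le_of_right h := h.le
  left_iff := by simp
  iff_of_lt h h' := by simp [h, h']
  iff_of_eq _ := by simp

variable {pa pb : α → α → Prop}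

theorem IsChildRule.left_mono (h : IsChildRule pa pb Q) {x y z : α} (hxy : x ≤ y) (hy : pa y z) :
    pa x z := by
  rcases hxy.eq_or_lt with rfl | hxy
  · exact hy
  · exact h.left_of_lt (hxy.trans_le (h.le_of_left hy))

theorem IsChildRule.right_mono (h : IsChildRule pa pb Q) {x y z : α} (hxy : x ≤ y)
    (hy : pb y z) : pb x z := by
  rcases hxy.eq_or_lt with rfl | hxy
  · exact hy
  · exact h.right_of_lt (hxy.trans_le (h.le_of_right hy))

-- Catalan numbers convolve to their own shift, so `configSum_conv` turns the extra sky point into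
-- cuts. These and the joins together give every admissible cut exactly once.
open Classical in
theorem configSum_catalan_succ (hQ : IsChildRule pa pb Q) (hlr : l ≤ r) :
    configSum Q f l (r + 1) catalan = ∑ c ∈ Finset.Icc l r,
      if (∀ i, l ≤ i → i < c → pa (f i) (f r)) ∧ (∀ i, c ≤ i → i < r → pb (f i) (f r)) then
        configSum Q f l c catalan * configSum Q f c r catalan else 0 := by
  obtain ⟨T, hT⟩ : ∃ T : ℕ → ℕ → ℕ, ∀ l r, configSum Q f l r catalan = T l r :=
    ⟨_, fun _ _ => rfl⟩
  have hself : ∀ l, T l l = 1 := fun l => by simp [← hT, configSum_self]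
  have hzero : ∀ {l r}, l < r → T l r = 0 ∨ ∀ i, l ≤ i → i < r → f i ≤ f (r - 1) := by
    intro l r _
    by_cases h : ∀ i, l ≤ i → i < r → f i ≤ f (r - 1)
    · exact .inr h
    · push Not at h
      obtain ⟨i, h1, h2, h3⟩ := h
      exact .inl ((hT _ _).symm.trans (configSum_eq_zero h1 h2 h3 _))
  rcases Nat.eq_or_lt_of_le hlr with rfl | hlt
  · rw [configSum_singleton]
    have hv : ∀ i, l ≤ i → ¬ i < l := fun i h => by omega
    rw [Finset.Icc_self, Finset.sum_singleton, if_pos, hT, hself, catalan_one]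
    exact ⟨fun i h h' => absurd h' (hv i h), fun i h h' => absurd h' (hv i h)⟩
  -- The two copies of `T l r` come from an empty initial group (`c = l`) and an empty final group.
  -- They will match the end cuts `c = l` and `c = r`.
  have hsky : configSum Q f l r (fun m => catalan (m + 1)) =
      ∑ c ∈ Finset.Ioo l r, (if f (c - 1) < f c then T l c * T c r else 0) + T l r + T l r := by
    rw [← conv_catalan, configSum_conv hlr, ← Finset.Ioo_insert_left hlt,
      Finset.sum_insert (by simp), if_pos (.inl rfl), catalan_zero, mul_one,
      add_comm (_ * _) (Finset.sum _ _)]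
    congr 1
    congr 1
    · refine Finset.sum_congr rfl fun c hc => ?_
      rw [Finset.mem_Ioo] at hc
      have : c ≠ l := by omega
      simp [this, hT]
    · rw [hT, hT, hself, one_mul]
    · rw [hT]
  have hI : Finset.Icc l r = insert l (insert r (Finset.Ioo l r)) := by
    ext c
    simp only [Finset.mem_Icc, Finset.mem_insert, Finset.mem_Ioo]
    omega
  rw [configSum_succ hlr, hsky, hI, Finset.sum_insert (by simp; omega),
    Finset.sum_insert (by simp)]
  simp only [hT, hself, one_mul, mul_one]
  have h1 : l ≠ r := by omega
  have v1 : (∀ i, l ≤ i → i < l → pa (f i) (f r)) ↔ True :=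
    iff_true_intro fun i h h' => by omega
  have v2 : (∀ i, r ≤ i → i < r → pb (f i) (f r)) ↔ True :=
    iff_true_intro fun i h h' => by omega
  simp only [h1, hlt, false_or, true_and, v1, v2, and_true]
  -- Unless the product vanishes, the last letter of each half is its maximum, so the rule needs
  -- checking only at `c - 1` and `r - 1`. If `f (r - 1) < f r`, an ascent at `c - 1` is a sky cut
  -- and a descent is a join; if the two letters are equal, only joins occur.
  have hterm : ∀ c ∈ Finset.Ioo l r,
      (if (∀ i, l ≤ i → i < c → pa (f i) (f r)) ∧ (∀ i, c ≤ i → i < r → pb (f i) (f r)) then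
        T l c * T c r else 0) =
      (if f (r - 1) < f r then if f (c - 1) < f c then T l c * T c r else 0 else 0) +
        if Joinable Q f c r then T l c * T c r else 0 := by
    intro c hc
    rw [Finset.mem_Ioo] at hc
    rcases hzero hc.1 with h0 | ha
    · simp [h0]
    rcases hzero hc.2 with h0 | hb
    · simp [h0]
    have ea : (∀ i, l ≤ i → i < c → pa (f i) (f r)) ↔ pa (f (c - 1)) (f r) :=
      ⟨fun h => h _ (by omega) (by omega), fun h i h1 h2 => hQ.left_mono (ha i h1 h2) h⟩
    have eb : (∀ i, c ≤ i → i < r → pb (f i) (f r)) ↔ pb (f (r - 1)) (f r) :=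
      ⟨fun h => h _ (by omega) (by omega), fun h i h1 h2 => hQ.right_mono (hb i h1 h2) h⟩
    have hc' := hb c le_rfl hc.2
    have hJ : Joinable Q f c r ↔ f (c - 1) ≤ f r ∧ f (r - 1) ≤ f r ∧
        (f c ≤ f (c - 1) ∨ f r ≤ f (r - 1)) ∧ Q (f (c - 1)) (f (r - 1)) (f r) := Iff.rfl
    simp only [ea, eb, hJ]
    rcases lt_trichotomy (f (r - 1)) (f r) with hf | hf | hf
    · rw [if_pos hf]
      simp only [hQ.right_of_lt hf, and_true, hf.le, true_and, hf.not_ge, or_false]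
      rcases lt_or_ge (f (c - 1)) (f c) with hx | hx
      · rw [if_pos hx, if_pos (hQ.left_of_lt (hx.trans (hc'.trans_lt hf))),
          if_neg fun h => hx.not_ge h.2.1, add_zero]
      · rw [if_neg hx.not_gt, zero_add]
        refine if_congr ?_ rfl rfl
        exact ⟨fun h => ⟨hQ.le_of_left h, hx, (hQ.iff_of_lt hf (hQ.le_of_left h)).2 h⟩,
          fun h => (hQ.iff_of_lt hf h.1).1 h.2.2⟩
    · simp only [hf, lt_irrefl, if_false, zero_add, le_refl, or_true, true_and]
      refine if_congr ?_ rfl rfl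
      exact ⟨fun h => ⟨hQ.le_of_left h.1, (hQ.iff_of_eq (hQ.le_of_left h.1)).2 h⟩,
        fun h => (hQ.iff_of_eq h.1).1 h.2⟩
    · rw [if_neg hf.not_gt, if_neg fun h => hf.not_ge (hQ.le_of_right h.2),
        if_neg fun h => hf.not_ge h.2.1]
  rw [Finset.sum_congr rfl hterm, Finset.sum_add_distrib]
  rcases hzero hlt with h0 | hb
  · simp only [h0, ite_self, add_zero, zero_add]
    split_ifs <;> simp
  have ea : (∀ i, l ≤ i → i < r → pa (f i) (f r)) ↔ pa (f (r - 1)) (f r) :=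
    ⟨fun h => h _ (by omega) (by omega), fun h i h1 h2 => hQ.left_mono (hb i h1 h2) h⟩
  have eb : (∀ i, l ≤ i → i < r → pb (f i) (f r)) ↔ pb (f (r - 1)) (f r) :=
    ⟨fun h => h _ (by omega) (by omega), fun h i h1 h2 => hQ.right_mono (hb i h1 h2) h⟩
  simp only [ea, eb]
  -- The end cuts remain: both are allowed below `f r`, exactly one at equality by `left_iff`, and
  -- none above.
  rcases lt_trichotomy (f (r - 1)) (f r) with hf | hf | hf
  · simp only [hf, if_true, hf.ne, if_false, hQ.left_of_lt hf, hQ.right_of_lt hf]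
    ring
  · simp only [hf, lt_irrefl, if_false, if_true, Finset.sum_const_zero, hQ.left_iff]
    split_ifs <;> simp
  · rw [if_neg hf.not_gt, if_neg hf.ne', if_neg fun h => hf.not_ge (hQ.le_of_right h),
      if_neg fun h => hf.not_ge (hQ.le_of_left h)]
    simp [hf.not_gt]

end Recursion

/-! ### Preimages under postorder readings -/

section Preimages

variable {pa pb : ℕ+ → ℕ+ → Prop} {Q : ℕ+ → ℕ+ → ℕ+ → Prop} {g : Word → Word}

/-- `g` reads words of the form `A n B`, with the letters of `A` and `B` related to `n` by `pa`
and `pb` respectively, in postorder. -/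
structure IsPostorder (pa pb : ℕ+ → ℕ+ → Prop) (g : Word → Word) : Prop where
  nil : g [] = []
  append_cons : ∀ {A B : Word} {n : ℕ+}, (∀ x ∈ A, pa x n) → (∀ x ∈ B, pb x n) →
    g (A ++ n :: B) = g A ++ g B ++ [n]

/-- Cut at the last maximal letter if equal letters may stand on the left, otherwise at the first.
-/
theorem IsChildRule.exists_append_cons (hQ : IsChildRule pa pb Q) {w : Word} (hw : w ≠ []) :
    ∃ (A : Word) (n : ℕ+) (B : Word), w = A ++ n :: B ∧ (∀ x ∈ A, pa x n) ∧ ∀ x ∈ B, pb x n := by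
  have hmax : ∀ x ∈ w, x ≤ w.max hw := fun x hx => List.le_max_of_mem hx
  have hmem : w.max hw ∈ w := List.max_mem hw
  generalize w.max hw = n at hmax hmem
  by_cases hn : pa n n
  · obtain ⟨B, A, h, hB⟩ := List.eq_append_cons_of_mem (List.mem_reverse.2 hmem)
    have h' : w = A.reverse ++ n :: B.reverse := by
      rw [← List.reverse_reverse w, h]
      simp
    refine ⟨A.reverse, n, B.reverse, h', fun x hx => ?_, fun x hx => ?_⟩
    · exact hQ.left_mono (hmax x (by rw [h']; simp only [List.mem_append]; exact .inl hx)) hn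
    · refine hQ.right_of_lt (lt_of_le_of_ne (hmax x ?_) ?_)
      · rw [h', List.mem_append, List.mem_cons]
        exact .inr (.inr hx)
      · rintro rfl
        exact hB (List.mem_reverse.1 hx)
  · obtain ⟨A, B, rfl, hA⟩ := List.eq_append_cons_of_mem hmem
    have hn' : pb n n := by
      by_contra h
      exact hn (hQ.left_iff.2 h)
    refine ⟨A, n, B, rfl, fun x hx => ?_, fun x hx => ?_⟩
    · refine hQ.left_of_lt (lt_of_le_of_ne (hmax x ?_) ?_)
      · rw [List.mem_append]
        exact .inl hx
      · rintro rfl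
        exact hA hx
    · refine hQ.right_mono (hmax x ?_) hn'
      rw [List.mem_append, List.mem_cons]
      exact .inr (.inr hx)

/-- With two different cuts, the `n` of each would lie in a part of the other, once on the left and
once on the right. Then both `pa n n` and `pb n n` would hold. -/
theorem IsChildRule.append_cons_inj (hQ : IsChildRule pa pb Q) {A B A' B' : Word} {n : ℕ+}
    (hA : ∀ x ∈ A, pa x n) (hB : ∀ x ∈ B, pb x n) (hA' : ∀ x ∈ A', pa x n)
    (hB' : ∀ x ∈ B', pb x n) (h : A ++ n :: B = A' ++ n :: B') : A = A' ∧ B = B' := by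
  have hn : ¬ (pa n n ∧ pb n n) := fun h => hQ.left_iff.1 h.1 h.2
  rcases List.append_eq_append_iff.1 h with ⟨C, rfl, hC⟩ | ⟨C, rfl, hC⟩
  · cases C with
    | nil => simpa using hC
    | cons x C =>
      simp only [List.cons_append, List.cons.injEq] at hC
      obtain ⟨rfl, rfl⟩ := hC
      exact absurd ⟨hA' n (by simp), hB n (by simp)⟩ hn
  · cases C with
    | nil =>
      simp only [List.nil_append, List.cons.injEq, true_and] at hC
      simp [hC]
    | cons x C =>
      simp only [List.cons_append, List.cons.injEq] at hC
      obtain ⟨rfl, rfl⟩ := hC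
      exact absurd ⟨hA n (by simp), hB' n (by simp)⟩ hn

theorem IsPostorder.perm (hg : IsPostorder pa pb g) (hQ : IsChildRule pa pb Q) (w : Word) :
    (g w).Perm w := by
  induction hk : w.length using Nat.strong_induction_on generalizing w with
  | _ k ih =>
    rcases eq_or_ne w [] with rfl | hw
    · rw [hg.nil]
    · obtain ⟨A, n, B, rfl, hA, hB⟩ := hQ.exists_append_cons hw
      simp only [List.length_append, List.length_cons] at hk
      rw [hg.append_cons hA hB]
      refine ((((ih _ (by omega) A rfl).append (ih _ (by omega) B rfl)).append_right [n])).trans ?_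
      rw [List.append_assoc]
      exact (List.perm_append_comm (l₁ := B) (l₂ := [n])).append_left A

theorem IsPostorder.finite_preimage (hg : IsPostorder pa pb g) (hQ : IsChildRule pa pb Q)
    (w : Word) : (g ⁻¹' {w}).Finite := by
  refine (w.permutations.toFinset.finite_toSet).subset ?_
  rintro x rfl
  simpa using (hg.perm hQ x).symm

/-- The word `f l, …, f (r - 1)`. -/
def segment (f : ℕ → ℕ+) (l r : ℕ) : Word := (List.range' l (r - l)).map f

variable {f : ℕ → ℕ+} {l r c : ℕ}

theorem segment_self : segment f l l = [] := by simp [segment]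

theorem length_segment : (segment f l r).length = r - l := by simp [segment]

theorem segment_append (hlc : l ≤ c) (hcr : c ≤ r) :
    segment f l c ++ segment f c r = segment f l r := by
  have h := List.range'_append_1 (s := l) (m := c - l) (n := r - c)
  rw [show l + (c - l) = c by omega, show c - l + (r - c) = r - l by omega] at h
  rw [segment, segment, segment, ← List.map_append, h]

theorem segment_succ (hlr : l ≤ r) : segment f l (r + 1) = segment f l r ++ [f r] := by
  rw [← segment_append hlr (Nat.le_succ r)]
  simp [segment]

theorem forall_mem_segment {p : ℕ+ → Prop} :
    (∀ x ∈ segment f l r, p x) ↔ ∀ i, l ≤ i → i < r → p (f i) := by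
  simp only [segment, List.mem_map, List.mem_range'_1, forall_exists_index, and_imp]
  constructor
  · intro h i h1 h2
    exact h _ i h1 (by omega) rfl
  · rintro h _ i h1 h2 rfl
    exact h i h1 (by omega)

theorem eq_segment_of_append_eq {A B : Word} (hlr : l ≤ r) (h : A ++ B = segment f l r) :
    ∃ c, l ≤ c ∧ c ≤ r ∧ A = segment f l c ∧ B = segment f c r := by
  have hlen := congrArg List.length h
  rw [List.length_append, length_segment] at hlen
  refine ⟨l + A.length, by omega, by omega, ?_⟩
  rw [← segment_append (c := l + A.length) (by omega) (by omega)] at h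
  exact List.append_inj h (by rw [length_segment]; omega)

-- The last letter of the image is the root. The images of its two sides are consecutive segments,
-- whose boundary is `c`.
open Classical in
theorem IsPostorder.ncard_preimage_succ (hg : IsPostorder pa pb g) (hQ : IsChildRule pa pb Q)
    (hlr : l ≤ r) :
    (g ⁻¹' {segment f l (r + 1)}).ncard = ∑ c ∈ Finset.Icc l r,
      if (∀ i, l ≤ i → i < c → pa (f i) (f r)) ∧ (∀ i, c ≤ i → i < r → pb (f i) (f r)) then
        (g ⁻¹' {segment f l c}).ncard * (g ⁻¹' {segment f c r}).ncard else 0 := by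
  set F : Word → Finset Word := fun w => (hg.finite_preimage hQ w).toFinset with hF
  have hcard : ∀ w, (g ⁻¹' {w}).ncard = (F w).card := fun w =>
    Set.ncard_eq_toFinset_card _ (hg.finite_preimage hQ w)
  have hmem : ∀ {x w}, x ∈ F w ↔ g x = w := fun {x w} => by simp [hF]
  -- Since `g` permutes letters, the rule can be tested on the images instead of on the unknown
  -- halves.
  have hperm : ∀ {x w} {p : ℕ+ → Prop}, x ∈ F w → ((∀ y ∈ x, p y) ↔ ∀ y ∈ w, p y) := by
    intro x w p hx
    rw [hmem] at hx
    simp only [← hx, (hg.perm hQ x).mem_iff]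
  simp only [hcard, ← forall_mem_segment (p := fun x => pa x (f r)),
    ← forall_mem_segment (p := fun x => pb x (f r))]
  rw [← Finset.sum_filter]
  have hset : F (segment f l (r + 1)) =
      {c ∈ Finset.Icc l r | (∀ x ∈ segment f l c, pa x (f r)) ∧
        ∀ x ∈ segment f c r, pb x (f r)}.biUnion fun c =>
        (F (segment f l c) ×ˢ F (segment f c r)).image fun p => p.1 ++ f r :: p.2 := by
    ext x
    simp only [Finset.mem_biUnion, Finset.mem_filter, Finset.mem_Icc, Finset.mem_image,
      Finset.mem_product, Prod.exists]
    constructor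
    · intro hx
      rw [hmem] at hx
      have hne : x ≠ [] := by
        rintro rfl
        rw [hg.nil, segment_succ hlr] at hx
        simp at hx
      obtain ⟨A, n, B, rfl, hA, hB⟩ := hQ.exists_append_cons hne
      rw [hg.append_cons hA hB, segment_succ hlr] at hx
      obtain ⟨hAB, hn⟩ := List.append_inj' hx rfl
      obtain rfl : n = f r := by simpa using hn
      obtain ⟨c, h1, h2, h3, h4⟩ := eq_segment_of_append_eq hlr hAB
      rw [← hmem] at h3 h4
      exact ⟨c, ⟨⟨h1, h2⟩, (hperm h3).1 hA, (hperm h4).1 hB⟩, A, B, ⟨h3, h4⟩, rfl⟩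
    · rintro ⟨c, ⟨⟨h1, h2⟩, hA, hB⟩, A, B, ⟨h3, h4⟩, rfl⟩
      rw [hmem, hg.append_cons ((hperm h3).2 hA) ((hperm h4).2 hB), hmem.1 h3, hmem.1 h4,
        segment_append h1 h2, segment_succ hlr]
  rw [hset, Finset.card_biUnion]
  · refine Finset.sum_congr rfl fun c hc => ?_
    rw [Finset.mem_filter] at hc
    rw [Finset.card_image_of_injOn, Finset.card_product]
    rintro p hp p' hp' h
    simp only [Finset.coe_product, Set.mem_prod, Finset.mem_coe] at hp hp'
    have := hQ.append_cons_inj ((hperm hp.1).2 hc.2.1) ((hperm hp.2).2 hc.2.2)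
      ((hperm hp'.1).2 hc.2.1) ((hperm hp'.2).2 hc.2.2) h
    exact Prod.ext this.1 this.2
  · intro c hc c' hc' hne
    rw [Finset.mem_coe, Finset.mem_filter, Finset.mem_Icc] at hc hc'
    rw [Function.onFun, Finset.disjoint_left]
    simp only [Finset.mem_image, Finset.mem_product, Prod.exists]
    rintro _ ⟨A, B, ⟨hA, hB⟩, rfl⟩ ⟨A', B', ⟨hA', hB'⟩, h⟩
    have := hQ.append_cons_inj ((hperm hA').2 hc'.2.1) ((hperm hB').2 hc'.2.2)
      ((hperm hA).2 hc.2.1) ((hperm hB).2 hc.2.2) h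
    rw [this.1] at hA'
    have h1 := congrArg List.length ((hmem.1 hA).symm.trans (hmem.1 hA'))
    rw [length_segment, length_segment] at h1
    omega

theorem IsPostorder.ncard_preimage_segment (hg : IsPostorder pa pb g) (hQ : IsChildRule pa pb Q)
    (hlr : l ≤ r) :
    (g ⁻¹' {segment f l r}).ncard = configSum Q f l r catalan := by
  classical
  induction r using Nat.strong_induction_on generalizing l with
  | _ r ih =>
    rcases Nat.eq_or_lt_of_le hlr with rfl | hlr
    · rw [segment_self, configSum_self, catalan_zero, Set.ncard_eq_one]
      refine ⟨[], ?_⟩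
      ext x
      simp only [Set.mem_preimage, Set.mem_singleton_iff]
      constructor
      · intro hx
        have := hg.perm hQ x
        rw [hx] at this
        exact this.symm.eq_nil
      · rintro rfl
        exact hg.nil
    · obtain ⟨r, rfl⟩ : ∃ k, r = k + 1 := ⟨r - 1, by omega⟩
      rw [hg.ncard_preimage_succ hQ (by omega), configSum_catalan_succ hQ (by omega)]
      refine Finset.sum_congr rfl fun c hc => ?_
      rw [Finset.mem_Icc] at hc
      rw [ih c (by omega) hc.1, ih r (by omega) hc.2]

theorem splitOn_eq_singleton {w : Word} {n : ℕ+} (h : n ∉ w) : w.splitOn n = [w] := by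
  induction w with
  | nil => simp
  | cons x t ih =>
    simp only [List.mem_cons, not_or] at h
    rw [List.splitOn_cons_eq_if_modifyHead, ih h.2]
    simp [Ne.symm h.1]

theorem max_eq_of_forall_le {w : Word} {n : ℕ+} (hn : n ∈ w) (hw : ∀ x ∈ w, x ≤ n)
    (h : w ≠ []) : w.max h = n :=
  le_antisymm (hw _ (List.max_mem h)) (List.le_max_of_mem hn)

/-- The upper bound `n` need not occur in `w`. This is what a side of the cut requires when it
contains no further `n`. -/
theorem fast_eq_of_forall_le {w : Word} {n : ℕ+} (hw : ∀ x ∈ w, x ≤ n) :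
    fast w = (w.splitOn n).flatMap fast ++ List.replicate (w.count n) n := by
  by_cases hn : n ∈ w
  · have h : w ≠ [] := List.ne_nil_of_mem hn
    rw [fast_of_ne_nil h, max_eq_of_forall_le hn hw h]
  · simp [splitOn_eq_singleton hn, List.count_eq_zero_of_not_mem hn]

theorem slow_eq_of_forall_le {w : Word} {n : ℕ+} (hw : ∀ x ∈ w, x ≤ n) :
    slow w = ((w.splitOn n).take 1).flatMap slow ++
      ((w.splitOn n).drop 1).flatMap fun A => slow A ++ [n] := by
  by_cases hn : n ∈ w
  · have h : w ≠ [] := List.ne_nil_of_mem hn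
    rw [slow_of_ne_nil h, max_eq_of_forall_le hn hw h]
  · simp [splitOn_eq_singleton hn]

theorem isPostorder_fast : IsPostorder (· < ·) (· ≤ ·) fast where
  nil := fast_nil
  append_cons {A B n} hA hB := by
    have hnA : n ∉ A := fun h => lt_irrefl _ (hA n h)
    rw [fast_eq_of_forall_le (n := n), fast_eq_of_forall_le hB, List.splitOn_append_cons_self,
      splitOn_eq_singleton hnA, List.count_append, List.count_cons_self,
      List.count_eq_zero_of_not_mem hnA, zero_add, List.replicate_succ']
    · simp
    · intro x hx
      rw [List.mem_append, List.mem_cons] at hx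
      rcases hx with hx | rfl | hx
      · exact (hA x hx).le
      · exact le_rfl
      · exact hB x hx

theorem isPostorder_slow : IsPostorder (· ≤ ·) (· < ·) slow where
  nil := slow_nil
  append_cons {A B n} hA hB := by
    have hnB : n ∉ B := fun h => lt_irrefl _ (hB n h)
    rw [slow_eq_of_forall_le (n := n), slow_eq_of_forall_le hA, List.splitOn_append_cons_self,
      splitOn_eq_singleton hnB]
    · cases hs : A.splitOn n with
      | nil => simp at hs
      | cons C L => simp
    · intro x hx
      rw [List.mem_append, List.mem_cons] at hx
      rcases hx with hx | rfl | hx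
      · exact hA x hx
      · exact le_rfl
      · exact (hB x hx).le

end Preimages

/-! ### From tuples of hooks to sets of pairs -/

section HookTuples

variable {w : Word} {Q : ℕ+ → ℕ+ → ℕ+ → Prop}

/-- The letter at position `i`, extended by `1` beyond the end of the word. -/
def letter (w : Word) (i : ℕ) : ℕ+ := w.getD i 1

theorem letter_eq {i : ℕ} (h : i < w.length) : w[i] = letter w i := by
  simp [letter, h]

theorem letter_fin (i : Fin w.length) : w[i] = letter w i := letter_eq i.2

theorem segment_letter : segment (letter w) 0 w.length = w := by
  refine List.ext_getElem (by simp [segment]) fun i h1 h2 => ?_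
  simp [segment, letter, h2]

namespace HookTuple

/-- The set of pairs of endpoint positions of the hooks of a tuple. -/
def pairs (H : HookTuple w) : Finset (ℕ × ℕ) :=
  Finset.univ.image fun u => (((H.2 u).sw : ℕ), ((H.2 u).ne : ℕ))

theorem mem_pairs {H : HookTuple w} {s e : ℕ} :
    (s, e) ∈ H.pairs ↔ ∃ u, ((H.2 u).sw : ℕ) = s ∧ ((H.2 u).ne : ℕ) = e := by
  simp [pairs]

theorem isDescent_iff {d : Fin w.length} : IsDescent w d ↔
    (d : ℕ) + 1 < w.length ∧ letter w (d + 1) ≤ letter w d := by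
  rw [IsDescent]
  constructor
  · rintro ⟨h, h'⟩
    rw [letter_eq, letter_fin] at h'
    exact ⟨h, h'⟩
  · rintro ⟨h, h'⟩
    refine ⟨h, ?_⟩
    rw [letter_eq, letter_fin]
    exact h'

/-- Each northeast endpoint already carries exactly one small hook, so the binary condition leaves
room for at most one other. -/
theorem isBinary_iff {H : HookTuple w} (hH : H.IsValid) : H.IsBinary ↔
    ∀ u v, (H.2 u).ne = (H.2 v).ne → ¬ (H.2 u).IsSmall → ¬ (H.2 v).IsSmall → u = v := by
  constructor
  · intro h u v huv hu hv
    by_contra hne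
    obtain ⟨t, ht, ht'⟩ := (hH.northeast u).2
    have := h (H.2 u).ne
    rw [← not_lt, Set.two_lt_ncard_iff (Set.toFinite _)] at this
    exact this ⟨u, v, t, rfl, huv.symm, ht, hne, fun h => hu (h ▸ ht'), fun h => hv (h ▸ ht')⟩
  · intro h j
    rw [← not_lt, Set.two_lt_ncard_iff (Set.toFinite _)]
    rintro ⟨a, b, c, ha, hb, hc, hab, hac, hbc⟩
    simp only [Set.mem_ofPred_eq] at ha hb hc
    have hs : ∀ {u v}, (H.2 u).ne = j → (H.2 v).ne = j → (H.2 u).IsSmall → (H.2 v).IsSmall →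
        u = v := by
      intro u v hu hv hu' hv'
      refine hH.sw_strictMono.injective (Fin.ext ?_)
      simp only [Hook.IsSmall, hu, hv] at hu' hv'
      omega
    have h1 := h a b (ha.trans hb.symm)
    have h2 := h a c (ha.trans hc.symm)
    have h3 := h b c (hb.trans hc.symm)
    have h4 := hs ha hb
    have h5 := hs ha hc
    have h6 := hs hb hc
    tauto

theorem isValid_and_isBinary_and_iff {H : HookTuple w} :
    (H.IsValid ∧ H.IsBinary ∧ ∀ u, ¬ (H.2 u).IsSmall →
      Q (letter w (H.2 u).sw) (letter w ((H.2 u).ne - 1)) (letter w (H.2 u).ne)) ↔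
    (StrictMono fun u => (H.2 u).sw) ∧ Valid Q (letter w) 0 w.length H.pairs := by
  have hlt : ∀ u, ((H.2 u).sw : ℕ) < (H.2 u).ne := fun u => (H.2 u).sw_lt_ne
  constructor
  · rintro ⟨hH, hb, hQ⟩
    rw [isBinary_iff hH] at hb
    refine ⟨hH.sw_strictMono, ?_⟩
    have hinj : ∀ {u v}, ((H.2 u).sw : ℕ) = (H.2 v).sw → u = v := fun h =>
      hH.sw_strictMono.injective (Fin.ext h)
    constructor <;> simp only [mem_pairs]
    · rintro _ _ ⟨u, rfl, rfl⟩
      refine ⟨Nat.zero_le _, hlt u, (H.2 u).ne.2, ?_⟩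
      rw [← letter_fin, ← letter_fin]
      exact (H.2 u).letter_le
    · rintro s _ _ ⟨u, rfl, rfl⟩ ⟨v, h, rfl⟩
      rw [hinj h]
    · intro d _ hd hd'
      obtain ⟨u, hu⟩ := hH.descent ⟨d, by omega⟩ (isDescent_iff.2 ⟨hd, hd'⟩)
      exact ⟨_, u, congrArg Fin.val hu, rfl⟩
    · rintro _ _ ⟨u, rfl, rfl⟩
      obtain ⟨v, hv, hv'⟩ := (hH.northeast u).2
      rw [Hook.IsSmall, hv] at hv'
      exact ⟨v, by omega, congrArg Fin.val hv⟩
    · rintro _ _ ⟨u, rfl, rfl⟩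
      obtain ⟨v, hv, hv'⟩ := (hH.northeast u).1
      exact ⟨(H.2 v).sw, ⟨v, rfl, congrArg Fin.val hv⟩, (isDescent_iff.1 hv').2⟩
    · rintro _ _ _ _ ⟨u, rfl, rfl⟩ ⟨v, rfl, rfl⟩ h
      have := hH.nested u v
      have := hlt u
      have := hlt v
      simp only [Fin.le_def] at *
      omega
    · rintro _ _ _ ⟨u, rfl, rfl⟩ ⟨v, rfl, h⟩ h1 h2
      rw [hb u v (Fin.ext h.symm) (by rw [Hook.IsSmall]; omega) (by rw [Hook.IsSmall]; omega)]
    · rintro _ _ ⟨u, rfl, rfl⟩ h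
      exact hQ u (by rw [Hook.IsSmall]; omega)
  · rintro ⟨hm, hV⟩
    have hp : ∀ u, (((H.2 u).sw : ℕ), ((H.2 u).ne : ℕ)) ∈ H.pairs := fun u =>
      mem_pairs.2 ⟨u, rfl, rfl⟩
    have hH : H.IsValid := by
      refine ⟨hm, fun d hd => ?_, fun u => ⟨?_, ?_⟩, fun u v => ?_⟩
      · rw [isDescent_iff] at hd
        obtain ⟨e, he⟩ := hV.descent d (Nat.zero_le _) hd.1 hd.2
        obtain ⟨u, hu, -⟩ := mem_pairs.1 he
        exact ⟨u, Fin.ext hu⟩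
      · obtain ⟨d, hd, hd'⟩ := hV.descentHook _ _ (hp u)
        obtain ⟨v, rfl, hv⟩ := mem_pairs.1 hd
        have := hlt v
        have := (H.2 v).ne.2
        exact ⟨v, Fin.ext hv, isDescent_iff.2 ⟨by omega, hd'⟩⟩
      · obtain ⟨v, hv, hv'⟩ := mem_pairs.1 (hV.small _ _ (hp u))
        have := hlt u
        exact ⟨v, Fin.ext hv', by rw [Hook.IsSmall]; omega⟩
      · have h1 := hV.nested _ _ _ _ (hp u) (hp v)
        have h2 := hV.nested _ _ _ _ (hp v) (hp u)
        simp only [Fin.le_def]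
        rcases lt_trichotomy u v with h | rfl | h
        · have : ((H.2 u).sw : ℕ) < (H.2 v).sw := hm h
          omega
        · omega
        · have : ((H.2 v).sw : ℕ) < (H.2 u).sw := hm h
          omega
    refine ⟨hH, (isBinary_iff hH).2 fun u v huv hu hv => ?_, fun u hu => ?_⟩
    · rw [Hook.IsSmall] at hu hv
      have h1 := hlt u
      have h2 := hlt v
      have h3 := hp v
      rw [← huv] at h3 hv h2
      exact hm.injective (Fin.ext (hV.binary _ _ _ (hp u) h3 (by omega) (by omega)))
    · rw [Hook.IsSmall] at hu
      have := hlt u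
      exact hV.edge _ _ (hp u) (by omega)

theorem eq_of_pairs_eq {H K : HookTuple w} (hH : StrictMono fun u => (H.2 u).sw)
    (hK : StrictMono fun u => (K.2 u).sw) (h : H.pairs = K.pairs) : H = K := by
  have hcard : ∀ {H : HookTuple w}, (StrictMono fun u => (H.2 u).sw) → H.pairs.card = H.1 := by
    intro H hH
    rw [pairs, Finset.card_image_of_injective, Finset.card_univ, Fintype.card_fin]
    intro u v huv
    exact hH.injective (Fin.ext (Prod.mk.inj huv).1)
  obtain ⟨k, H⟩ := H
  obtain ⟨k', K⟩ := K
  obtain rfl : k = k' := (hcard hH).symm.trans ((congrArg Finset.card h).trans (hcard hK))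
  have hsub : ∀ {H K : Fin k → Hook w}, pairs ⟨k, H⟩ = pairs ⟨k, K⟩ → ∀ u, ∃ v, K v = H u := by
    intro H K h u
    have : (((H u).sw : ℕ), ((H u).ne : ℕ)) ∈ pairs ⟨k, K⟩ := h ▸ mem_pairs.2 ⟨u, rfl, rfl⟩
    obtain ⟨v, h1, h2⟩ := mem_pairs.1 this
    exact ⟨v, Hook.ext (Fin.ext h1) (Fin.ext h2)⟩
  have hsw : (fun u => (H u).sw) = fun u => (K u).sw := by
    refine (hH.range_inj hK).1 (Set.Subset.antisymm ?_ ?_)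
    · rintro _ ⟨u, rfl⟩
      obtain ⟨v, hv⟩ := hsub h u
      exact ⟨v, congrArg Hook.sw hv⟩
    · rintro _ ⟨u, rfl⟩
      obtain ⟨v, hv⟩ := hsub h.symm u
      exact ⟨v, congrArg Hook.sw hv⟩
  congr 1
  funext u
  obtain ⟨v, hv⟩ := hsub h u
  have : v = u := by
    refine hK.injective ?_
    have := congrFun hsw u
    simp only at this ⊢
    rw [hv, this]
  rw [← hv, this]

/-- Southwest positions determine their hooks, so listing those positions in increasing order yields
the tuple. -/
theorem exists_pairs_eq {S : Finset (ℕ × ℕ)} (hS : Valid Q (letter w) 0 w.length S) :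
    ∃ H : HookTuple w, (StrictMono fun u => (H.2 u).sw) ∧ H.pairs = S := by
  classical
  set D := S.image Prod.fst
  have hex : ∀ u : Fin D.card, ∃ e, (D.orderEmbOfFin rfl u, e) ∈ S := fun u => by
    obtain ⟨⟨s, e⟩, h, h'⟩ := Finset.mem_image.1 (D.orderEmbOfFin_mem rfl u)
    exact ⟨e, by rw [← h']; exact h⟩
  choose e he using hex
  have hb := fun u => hS.bounds _ _ (he u)
  refine ⟨⟨D.card, fun u => ⟨⟨D.orderEmbOfFin rfl u, by have := hb u; omega⟩,
    ⟨e u, (hb u).2.2.1⟩, (hb u).2.1, ?_⟩⟩, ?_, ?_⟩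
  · rw [letter_fin, letter_fin]
    exact (hb u).2.2.2
  · intro u v huv
    exact (D.orderEmbOfFin rfl).strictMono huv
  · ext ⟨s, t⟩
    rw [mem_pairs]
    constructor
    · rintro ⟨u, rfl, rfl⟩
      exact he u
    · intro h
      have hs : s ∈ Set.range (D.orderEmbOfFin rfl) := by
        rw [Finset.range_orderEmbOfFin]
        exact Finset.mem_image_of_mem Prod.fst h
      obtain ⟨u, rfl⟩ := hs
      exact ⟨u, rfl, hS.unique _ _ _ (he u) h⟩

theorem sees_iff {H : HookTuple w} {i : Fin w.length} {u : Fin H.1} :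
    H.Sees i u ↔ StackSortWords.Sees (letter w) i ((H.2 u).sw, (H.2 u).ne) := by
  simp only [Sees, Hook.LiesAbove, StackSortWords.Sees, letter_fin, Fin.lt_def, Fin.ext_iff]

theorem forall_pairs {H : HookTuple w} {p : ℕ × ℕ → Prop} :
    (∀ h ∈ H.pairs, p h) ↔ ∀ u, p ((H.2 u).sw, (H.2 u).ne) := by
  simp [pairs]

theorem ncard_fin (n : ℕ) (p : ℕ → Prop) [DecidablePred p] :
    {i : Fin n | p i}.ncard = {i ∈ Finset.Ico 0 n | p i}.card := by
  rw [← Set.ncard_image_of_injective _ Fin.val_injective, ← Set.ncard_coe_finset]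
  congr 1
  ext i
  simp only [Set.mem_image, Set.mem_ofPred_eq, Finset.coe_filter, Finset.mem_Ico]
  constructor
  · rintro ⟨j, hj, rfl⟩
    exact ⟨⟨Nat.zero_le _, j.2⟩, hj⟩
  · rintro ⟨h1, h2⟩
    exact ⟨⟨i, h1.2⟩, h2, rfl⟩

theorem catalanProd_q {H : HookTuple w} (hH : StrictMono fun u => (H.2 u).sw) :
    catalanProd H.q = hookWeight (letter w) 0 w.length H.pairs *
      catalan (skyCount (letter w) 0 w.length H.pairs) := by
  classical
  rw [catalanProd, Fin.prod_univ_succ, mul_comm]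
  congr 1
  · rw [hookWeight, pairs, Finset.prod_image]
    · refine Finset.prod_congr rfl fun u _ => ?_
      rw [q, Fin.cons_succ, hookCount, ← ncard_fin]
      congr 2
      ext i
      simp only [Set.mem_ofPred_eq, HasColor, sees_iff, Finset.forall_mem_image,
        Finset.mem_univ, forall_const, Fin.le_def]
    · intro u _ v _ huv
      exact hH.injective (Fin.ext (Prod.mk.inj huv).1)
  · rw [q, Fin.cons_zero, skyCount, ← ncard_fin]
    congr 2
    ext i
    simp only [Set.mem_ofPred_eq, HasSkyColor, sees_iff, forall_pairs]

theorem sum_catalanProd {s : Finset (HookTuple w)}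
    (hs : ∀ H, H ∈ s ↔ H.IsValid ∧ H.IsBinary ∧ ∀ u, ¬ (H.2 u).IsSmall →
      Q (letter w (H.2 u).sw) (letter w ((H.2 u).ne - 1)) (letter w (H.2 u).ne)) :
    ∑ H ∈ s, catalanProd H.q = configSum Q (letter w) 0 w.length catalan := by
  simp only [isValid_and_isBinary_and_iff] at hs
  refine Finset.sum_bij (fun H _ => H.pairs) (fun H hH => mem_configs.2 ((hs H).1 hH).2)
    (fun H hH K hK h => eq_of_pairs_eq ((hs H).1 hH).1 ((hs K).1 hK).1 h) (fun S hS => ?_)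
    (fun H hH => catalanProd_q ((hs H).1 hH).1)
  obtain ⟨H, hH, rfl⟩ := exists_pairs_eq (mem_configs.1 hS)
  exact ⟨H, (hs H).2 ⟨hH, mem_configs.1 hS⟩, rfl⟩

end HookTuple

theorem sum_hooksR (w : Word) : ∑ H ∈ hooksR w, catalanProd H.q =
    configSum (fun x _ z => x < z) (letter w) 0 w.length catalan := by
  refine HookTuple.sum_catalanProd fun H => ?_
  rw [mem_hooksR]
  refine and_congr_right fun _ => and_congr_right fun _ => forall_congr' fun u => ?_
  have hle := (H.2 u).letter_le
  rw [Hook.IsHorizontal]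
  rw [letter_fin, letter_fin] at *
  constructor
  · intro h hs
    exact lt_of_le_of_ne hle fun h' => hs (h h')
  · intro h h'
    by_contra hs
    exact (h hs).ne h'

/-- A long hook to `e` shares its endpoint with the small hook from `e - 1`. Forbidding that small
hook to be horizontal amounts to requiring the letter at `e - 1` to be below the letter at `e`. -/
theorem sum_hooksL (w : Word) : ∑ H ∈ hooksL w, catalanProd H.q =
    configSum (fun _ y z => y < z) (letter w) 0 w.length catalan := by
  refine HookTuple.sum_catalanProd fun H => ?_
  rw [mem_hooksL]
  refine and_congr_right fun hH => and_congr_right fun _ => ?_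
  have hne : ∀ {u}, (H.2 u).IsSmall → ((H.2 u).ne : ℕ) - 1 = (H.2 u).sw := fun {u} h => by
    rw [Hook.IsSmall] at h
    omega
  constructor
  · intro h u hu
    obtain ⟨v, hv, hs⟩ := (hH.northeast u).2
    have hle := (H.2 v).letter_le
    have h1 := h v hs
    rw [Hook.IsHorizontal] at h1
    rw [letter_fin, letter_fin] at h1 hle
    have h2 := hne hs
    rw [← hv, h2]
    refine lt_of_le_of_ne hle fun h' => h1 h' u (fun huv => hu (huv ▸ hs)) hv.symm
  · intro h u hs hz v hvu hv
    -- Two small hooks with a common northeast endpoint also share their southwest endpoint, hence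
    -- coincide.
    have hv' : ¬ (H.2 v).IsSmall := fun hv' => hvu (hH.sw_strictMono.injective (Fin.ext (by
      have h1 := hne hs
      have h2 := hne hv'
      rw [hv] at h2
      exact h2.symm.trans h1)))
    have h1 := h v hv'
    rw [Hook.IsHorizontal, letter_fin, letter_fin] at hz
    rw [hv, hne hs, hz] at h1
    exact lt_irrefl _ h1

theorem IsPostorder.preimage_finite_and_ncard {pa pb : ℕ+ → ℕ+ → Prop} {g : Word → Word}
    (hg : IsPostorder pa pb g) (hQ : IsChildRule pa pb Q) (w : Word) :
    (g ⁻¹' {w}).Finite ∧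
      (g ⁻¹' {w}).ncard = configSum Q (letter w) 0 w.length catalan := by
  refine ⟨hg.finite_preimage hQ w, ?_⟩
  rw [← hg.ncard_preimage_segment hQ (Nat.zero_le _), segment_letter]

end HookTuples
end StackSortWords

theorem mainTheorem1 (w : StackSortWords.Word) :
    ((StackSortWords.fast ⁻¹' {w}).Finite ∧
      (StackSortWords.fast ⁻¹' {w}).ncard =
        ∑ H ∈ StackSortWords.hooksR w, StackSortWords.catalanProd H.q) ∧
    ((StackSortWords.slow ⁻¹' {w}).Finite ∧
      (StackSortWords.slow ⁻¹' {w}).ncard =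
        ∑ H ∈ StackSortWords.hooksL w, StackSortWords.catalanProd H.q) := by
  rw [StackSortWords.sum_hooksR, StackSortWords.sum_hooksL]
  exact ⟨StackSortWords.isPostorder_fast.preimage_finite_and_ncard
      StackSortWords.isChildRule_lt_le w,
    StackSortWords.isPostorder_slow.preimage_finite_and_ncard
      StackSortWords.isChildRule_le_lt w⟩
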